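/- Let $n\ge 2$ and let $\mathcal D$ be a digraph on $\{1,\dots,n\}$ without self-loops; an edge $(i,j)$ means that information flows from $j$ to $i$, and $\mathcal N_i=\{j:(i,j)\text{ is an edge}\}$. Let $\mathcal A$ be its 0-1 adjacency matrix and $L=\Delta-\mathcal A$ its Laplacian, where $\Delta$ is diagonal with $\Delta_{ii}=\sum_{j\ne i}\mathcal A_{ij}$. Assume that $\mathcal D$ contains a directed spanning tree (some root reaches every node by a directed path). Let $Q\in\mathbb R^{(n-1)\times n}$ satisfy $Q1_n=0$ and $QQ^\top=I$, and put $\bar L=QLQ^\top$. **Closed loop.** Vehicle $i$ has a differentiable desired trajectory $p_{d,i}:[0,t_f]\to\mathbb R^3$, an actual position $p_i(t)\in\mathbb R^3$, and a coordination state $\gamma_i(t)\in[0,t_f]$, on a time interval $[0,T)$ with $0<T\le\infty$. Let $\dot\gamma_d$ be a differentiable desired pace, let $e_{PF,i}(t)=p_i(t)-p_{d,i}(\gamma_i(t))$, and let $e_{PF}$ be the vector of all $e_{PF,i}$. For $a,b,\eta,k_{PF}>0$ the states obey $$\ddot\gamma_i=-b(\dot\gamma_i-\dot\gamma_d)-a\sum_{j\in\mathcal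 N_i}(\gamma_i-\hat\gamma_j)+\bar\alpha_i,\qquad \bar\alpha_i=k_{PF}\,\frac{\dot p_{d,i}(\gamma_i)^\top e_{PF,i}}{\|\dot p_{d,i}(\gamma_i)\|+\eta},$$ where $\ddot\gamma_i$ is the right derivative of the continuous function $\dot\gamma_i$. Vehicle $j$ has event times $0=t^j_0<t^j_1<\cdots$ (finitely or infinitely many) in $[0,T)$, only finitely many before any time smaller than $T$. Between consecutive events $\ddot{\hat\gamma}_j=-b(\dot{\hat\gamma}_j-\dot\gamma_d)$, and at each event $\hat\gamma_j$ and $\dot{\hat\gamma}_j$ are reset to $\gamma_j$ and $\dot\gamma_j$. With $e_j=\hat\gamma_j-\gamma_j$ and the threshold $h(t)=c_1+c_2e^{-c_3t}$ ($c_1>0$, $c_2,c_3\ge0$), an event takes place when $|e_j|$ reaches $h$: always $|e_j(t)|\le h(t)$, and the left limit of $|e_j|$ at $t^j_{k+1}$ is $h(t^j_{k+1})$. The coordination error is $\xi_{TC}=(Q\gamma,\ \dot\gamma-\dot\gamma_d1_n)\in\mathbb R^{2n-1}$. **Theorem.** For every symmetric positive definite $\Xi\in\mathbb R^{(n-1)\times(n-1)}$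 there is a symmetric positive definite $\Psi$ with $\bar L^\top\Psi+\Psi\bar L=\Xi$ such that the following holds for all $\beta>0$, $r>0$ and all $\lambda_{TC}$ with $0<\lambda_{TC}\le r\,\frac{\lambda_{\min}(\Xi)}{3\lambda_{\max}(\Psi)}$. There are gains $a,b,\eta>0$ with $a/b=r$ such that, for all $k_{PF}>0$, $c_1>0$, $c_2,c_3\ge0$, $\rho>0$ and $D$: 1. Every closed loop as above with $\|e_{PF}(t)\|\le\rho$ and $|\ddot\gamma_d(t)|\le D$ on $[0,T)$ satisfies, for all $t\in[0,T)$, $$\|\xi_{TC}(t)\|\le\kappa_1\|\xi_{TC}(0)\|e^{-\lambda_{TC}t}+\kappa_2\sup_{0\le s<T}\bigl(an\sqrt n\,h(s)+k_{PF}\|e_{PF}(s)\|+|\ddot\gamma_d(s)|\bigr),$$ where, with $S=\begin{bmatrix}bI_{n-1}&Q\\0&I_n\end{bmatrix}$, $\mu=\min\{\lambda_{\min}(\Psi),\beta/2\}$, $M=\max\{\lambda_{\max}(\Psi),\beta/2\}$ and the operator norm induced by the Euclidean norm, $$\kappa_1=\|S^{-1}\|\sqrt{M/\mu}\,\|S\|,\qquad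 \kappa_2=\|S^{-1}\|\sqrt{M/\mu}\;\frac{2\lambda_{\max}(\Psi)+\beta}{\lambda_{TC}\,\mu}.$$ 2. For every $R$ there is $\delta>0$ such that in every closed loop as in 1 with $\|\xi_{TC}(0)\|\le R$, any two consecutive event times of any vehicle satisfy $t^i_{k+1}-t^i_k\ge\delta$. In particular Zeno behaviour is excluded. -/

import Mathlib

open Set Filter Topology

noncomputable section

namespace TimeCoord

/-- Physical space `ℝ³` with the Euclidean norm. -/
abbrev E3 : Type := EuclideanSpace ℝ (Fin 3)

/-! ### Communication digraph

`G.Adj i j` means that `(i, j)` is an edge, i.e. information flows from node `j` to node `i`. -/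

/-- The 0-1 adjacency matrix. -/
def adjacency {n : ℕ} (G : Digraph (Fin n)) : Matrix (Fin n) (Fin n) ℝ :=
  open scoped Classical in Matrix.of fun i j => if G.Adj i j then 1 else 0

/-- The Laplacian `L = Δ - 𝒜`, where `Δ i i = ∑ j ≠ i, 𝒜 i j`. -/
def laplacian {n : ℕ} (G : Digraph (Fin n)) : Matrix (Fin n) (Fin n) ℝ :=
  Matrix.diagonal (fun i => ∑ j ∈ Finset.univ.erase i, adjacency G i j) - adjacency G

/-- The neighbourhood `𝒩 i = {j | (i, j) is an edge}`. -/
def nbrs {n : ℕ} (G : Digraph (Fin n)) (i : Fin n) : Finset (Fin n) :=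
  open scoped Classical in Finset.univ.filter fun j => G.Adj i j

/-- Some root node reaches every node by a directed path. A path from `r` to `i` is a sequence of
edges `(i, i₁), (i₁, i₂), …, (iₛ₋₁, r)`. -/
def HasDirectedSpanningTree {n : ℕ} (G : Digraph (Fin n)) : Prop :=
  ∃ r, ∀ i, Relation.ReflTransGen G.Adj i r

/-! ### Matrices -/

/-- Least eigenvalue of a real symmetric matrix. -/
def lambdaMin {m : ℕ} (M : Matrix (Fin m) (Fin m) ℝ) : ℝ := sInf (spectrum ℝ M)

/-- Largest eigenvalue of a real symmetric matrix. -/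
def lambdaMax {m : ℕ} (M : Matrix (Fin m) (Fin m) ℝ) : ℝ := sSup (spectrum ℝ M)

/-- The operator norm of a square matrix induced by the Euclidean norm. -/
def opNorm {ι : Type} [Fintype ι] [DecidableEq ι] (M : Matrix ι ι ℝ) : ℝ :=
  ‖Matrix.toEuclideanCLM (n := ι) (𝕜 := ℝ) M‖

/-- `S = [[b I, Q], [0, I]]`. -/
def Smat {n : ℕ} (Q : Matrix (Fin (n - 1)) (Fin n) ℝ) (b : ℝ) :
    Matrix (Fin (n - 1) ⊕ Fin n) (Fin (n - 1) ⊕ Fin n) ℝ :=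
  Matrix.fromBlocks (b • (1 : Matrix (Fin (n - 1)) (Fin (n - 1)) ℝ)) Q 0 1

/-- `κ₁ = ‖S⁻¹‖ √(max{λmax Ψ, β/2} / min{λmin Ψ, β/2}) ‖S‖`. -/
def kappa1 {n : ℕ} (Q : Matrix (Fin (n - 1)) (Fin n) ℝ)
    (Ψ : Matrix (Fin (n - 1)) (Fin (n - 1)) ℝ) (β b : ℝ) : ℝ :=
  opNorm (Smat Q b)⁻¹ * √(max (lambdaMax Ψ) (β / 2) / min (lambdaMin Ψ) (β / 2)) *
    opNorm (Smat Q b)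

/-- `κ₂ = ‖S⁻¹‖ √(max{λmax Ψ, β/2} / min{λmin Ψ, β/2}) (2 λmax Ψ + β) / (lam min{λmin Ψ, β/2})`. -/
def kappa2 {n : ℕ} (Q : Matrix (Fin (n - 1)) (Fin n) ℝ)
    (Ψ : Matrix (Fin (n - 1)) (Fin (n - 1)) ℝ) (β b lam : ℝ) : ℝ :=
  opNorm (Smat Q b)⁻¹ * √(max (lambdaMax Ψ) (β / 2) / min (lambdaMin Ψ) (β / 2)) *
    ((2 * lambdaMax Ψ + β) / (lam * min (lambdaMin Ψ) (β / 2)))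

/-! ### The event-triggered closed loop -/

/-- The threshold `h(t) = c₁ + c₂ exp(-c₃ t)`. -/
def threshold (c₁ c₂ c₃ t : ℝ) : ℝ := c₁ + c₂ * Real.exp (-c₃ * t)

/-- The signals of a mission of `n` vehicles on a time interval `[0, T)`, `0 < T ≤ ∞`; the values
of the signals outside `[0, T)` play no role. -/
structure Run (n : ℕ) where
  /-- the end of the time interval -/
  T : EReal
  /-- the final time of the desired trajectories -/
  tf : ℝ
  /-- the desired trajectories, on `[0, tf]` -/
  pd : Fin n → ℝ → E3
  /-- the actual positions of the vehicles -/
  p : Fin n → ℝ → E3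
  /-- the desired pace (the first derivative of `γ_d`) -/
  dγd : ℝ → ℝ
  /-- the derivative of the desired pace -/
  ddγd : ℝ → ℝ
  /-- the coordination states -/
  γ : Fin n → ℝ → ℝ
  /-- their rates -/
  dγ : Fin n → ℝ → ℝ
  /-- the estimates of the coordination states -/
  γhat : Fin n → ℝ → ℝ
  /-- the rates of the estimates -/
  dγhat : Fin n → ℝ → ℝ
  /-- `τ i k` is the `k`-th event time of vehicle `i`; it is `⊤` if there is no `k`-th event -/
  τ : Fin n → ℕ → EReal

namespace Run

variable {n : ℕ} (x : Run n)

/-- The times `[0, T)` of the run. -/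
def times : Set ℝ := {t | 0 ≤ t ∧ (t : EReal) < x.T}

/-- The part of `[τ j k, τ j (k + 1))` in `[0, T)`. -/
def slot (j : Fin n) (k : ℕ) : Set ℝ :=
  {t | t ∈ x.times ∧ x.τ j k ≤ (t : EReal) ∧ (t : EReal) < x.τ j (k + 1)}

/-- The path-following error of vehicle `i`. -/
def ePFi (i : Fin n) (t : ℝ) : E3 := x.p i t - x.pd i (x.γ i t)

/-- The stacked path-following error, with the Euclidean norm of `ℝ³ⁿ`. -/
def ePF (t : ℝ) : PiLp 2 (fun _ : Fin n => E3) := WithLp.toLp 2 fun i => x.ePFi i t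

/-- The velocity of the desired trajectory of vehicle `i` at the parameter `γ i t`. -/
def vel (i : Fin n) (t : ℝ) : E3 := derivWithin (x.pd i) (Icc 0 x.tf) (x.γ i t)

/-- The path-following feedback term. -/
def alphaBar (kPF η : ℝ) (i : Fin n) (t : ℝ) : ℝ :=
  kPF * (inner ℝ (x.vel i t) (x.ePFi i t) / (‖x.vel i t‖ + η))

/-- The estimation error. -/
def e (j : Fin n) (t : ℝ) : ℝ := x.γhat j t - x.γ j t

/-- The coordination error `(Q γ, dγ - dγd 1)`, with the Euclidean norm of `ℝ²ⁿ⁻¹`. -/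
def xiTC (Q : Matrix (Fin (n - 1)) (Fin n) ℝ) (t : ℝ) : EuclideanSpace ℝ (Fin (n - 1) ⊕ Fin n) :=
  WithLp.toLp 2 (Sum.elim (Q.mulVec fun i => x.γ i t) fun i => x.dγ i t - x.dγd t)

/-- The signals obey the event-triggered coordination law with gains `a, b, kPF, η` and threshold
function `h` over the digraph `G`.

The run is not assumed to be free of Zeno behaviour: every time before `T` is preceded by finitely
many events only, but infinitely many of them may accumulate at a finite `T`. -/
structure IsClosedLoop (G : Digraph (Fin n)) (a b kPF η : ℝ) (h : ℝ → ℝ) : Prop where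
  T_pos : 0 < x.T
  tf_pos : 0 < x.tf
  pd_diff : ∀ i, DifferentiableOn ℝ (x.pd i) (Icc 0 x.tf)
  γ_mem : ∀ i, ∀ t ∈ x.times, x.γ i t ∈ Icc 0 x.tf
  dγd_deriv : ∀ t ∈ x.times, HasDerivWithinAt x.dγd (x.ddγd t) (Ici 0) t
  γ_deriv : ∀ i, ∀ t ∈ x.times, HasDerivWithinAt (x.γ i) (x.dγ i t) (Ici 0) t
  dγ_cont : ∀ i, ContinuousOn (x.dγ i) x.times
  /-- The control law. The derivative is the right one since the estimates jump at events. -/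
  control : ∀ i, ∀ t ∈ x.times, HasDerivWithinAt (x.dγ i)
    (-b * (x.dγ i t - x.dγd t) - a * ∑ j ∈ nbrs G i, (x.γ i t - x.γhat j t)
      + x.alphaBar kPF η i t) (Ici t) t
  /-- Event times: the first one is `0`, they increase strictly as long as there are any, they lie
  before `T`, and `[0, T)` is covered by the intervals between consecutive events. -/
  τ_zero : ∀ j, x.τ j 0 = 0
  τ_lt : ∀ j k, x.τ j k < x.τ j (k + 1) ∨ x.τ j (k + 1) = ⊤
  τ_lt_T : ∀ j k, x.τ j k < x.T ∨ x.τ j k = ⊤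
  τ_cover : ∀ j, ∀ t ∈ x.times, ∃ k, t ∈ x.slot j k
  /-- The estimator between events. -/
  est_deriv : ∀ j k, ∀ t ∈ x.slot j k, HasDerivWithinAt (x.γhat j) (x.dγhat j t) (x.slot j k) t
  est_ode : ∀ j k, ∀ t ∈ x.slot j k,
    HasDerivWithinAt (x.dγhat j) (-b * (x.dγhat j t - x.dγd t)) (x.slot j k) t
  /-- The estimator is reset at events. -/
  est_reset : ∀ j k, ∀ t : ℝ, x.τ j k = (t : EReal) →
    x.γhat j t = x.γ j t ∧ x.dγhat j t = x.dγ j t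
  /-- The threshold is not exceeded without an event taking place. -/
  no_event : ∀ j, ∀ t ∈ x.times, |x.e j t| ≤ h t
  /-- Every event after the initial one is triggered by the error reaching the threshold. -/
  event : ∀ j k, ∀ t : ℝ, x.τ j (k + 1) = (t : EReal) →
    Tendsto (fun s => |x.e j s|) (𝓝[<] t) (𝓝 (h t))

end Run

end TimeCoord

end

/-!
The closed loop is a stable linear system driven by bounded perturbations, once it is written in
the right coordinates. Since the Laplacian annihilates the constants, it factors through the
disagreement `q = Q γ` (`laplacian_mul_transpose_mul`). With `z = dγ - dγd 1`, `χ = b q + Q z` and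
`a = r b` the system becomes

  `χ' = -r L̄ χ + r L̄ Q z + Q u`,   `z' = -b z + r L z - r L Qᵀ χ + u`,

where `u` collects the estimation errors, the path-following feedback and the change of the desired
pace. The last of these is a multiple of the constant vector, hence absent from `Q u`.

*The matrix `Ψ`.* By the maximum principle and the spanning tree, the eigenvalues of `L̄ = Q L Qᵀ`
have positive real part (`posStable_reduced_laplacian`). Hence the Cayley transform
`C = (1 - L̄)(1 + L̄)⁻¹` has spectral radius less than one and `Cᵏ → 0`. The Lyapunov equation for
`Ψ` is equivalent to `Ψ = Cᵀ Ψ C + W` with `W` positive definite, and iterating this identity yields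
both the unique solvability of the equation and the positivity of `Ψ`
(`PosStable.exists_lyapunov`).

*Convergence.* In the derivative of `V = ⟪χ, Ψ χ⟫ + (β / 2) ‖z‖²` the gain `b` occurs only in the
damping term `-β b ‖z‖²`: the couplings of `χ` and `z` depend on the ratio `r` alone. A large `b`
therefore absorbs every term that contains `z`, among them the perturbation of `z`, although its
norm is only bounded by `√n U`, where `U` is the supremum in the theorem
(`exists_gain_energy_decay`). The bound on `lam` leaves a rate of decay `3 lam` for the `χ` part.
What remains is `V' < -2 lam s (s - θ U)` whenever `s = √V ≥ θ U`, and comparison with the solutions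
of `s' = -lam (s - θ U)` gives the estimate (`le_sq_of_deriv_lt`, `exists_gain_norm_xiTC_le`).

*Events.* Between events, the rate `f` of the estimation error of a vehicle satisfies
`f' = -b f + g`, where `g` is bounded in terms of `R` by the first part. As `f` vanishes at the
event, `|f| ≤ K / b`, and the error needs at least the time `c₁ b / K` to reach the threshold
(`Run.IsClosedLoop.add_le_τ_succ`).
-/

/-! ### Stable matrices and the Lyapunov equation -/

namespace TimeCoord

open scoped Matrix.Norms.L2Operator in
/-- A form of Gelfand's formula: the powers of a complex matrix whose eigenvalues lie in the open
unit disc tend to zero. -/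
theorem tendsto_pow_zero_of_spectrum_lt_one {m : ℕ} (C : Matrix (Fin m) (Fin m) ℂ)
    (h : ∀ μ ∈ spectrum ℂ C, ‖μ‖ < 1) : Tendsto (fun k : ℕ => C ^ k) atTop (𝓝 0) := by
  rcases isEmpty_or_nonempty (Fin m) with hm | hm
  · have : ∀ k : ℕ, C ^ k = 0 := fun k => Subsingleton.elim _ _
    simp only [this, tendsto_const_nhds]
  have hr : spectralRadius ℂ C < ((1 : NNReal) : ENNReal) :=
    spectrum.spectralRadius_lt_of_forall_lt C fun μ hμ => by exact_mod_cast h μ hμ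
  obtain ⟨q, hq1, hq2⟩ := ENNReal.lt_iff_exists_nnreal_btwn.1 hr
  have hq2' : q < 1 := by exact_mod_cast hq2
  have hev := (spectrum.pow_nnnorm_pow_one_div_tendsto_nhds_spectralRadius C).eventually_lt_const
    hq1
  rw [tendsto_zero_iff_norm_tendsto_zero]
  refine squeeze_zero' (g := fun k : ℕ => (q : ℝ) ^ k) (Eventually.of_forall fun _ => norm_nonneg _)
    ?_ (tendsto_pow_atTop_nhds_zero_of_lt_one q.2 (by exact_mod_cast hq2'))
  filter_upwards [hev, eventually_gt_atTop 0] with k hk hk0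
  have hk0' : (0 : ℝ) < k := by exact_mod_cast hk0
  have h1 : ((‖C ^ k‖₊ : ENNReal) ^ (1 / k : ℝ)) ^ (k : ℝ) ≤ (q : ENNReal) ^ (k : ℝ) :=
    ENNReal.rpow_le_rpow hk.le hk0'.le
  rw [← ENNReal.rpow_mul, one_div_mul_cancel hk0'.ne', ENNReal.rpow_one, ENNReal.rpow_natCast] at h1
  have h2 : ‖C ^ k‖₊ ≤ q ^ k := by exact_mod_cast h1
  exact_mod_cast h2

/-- All eigenvalues of the real matrix `A`, acting on complex vectors, have positive real part. -/
def PosStable {m : ℕ} (A : Matrix (Fin m) (Fin m) ℝ) : Prop :=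
  ∀ (z : ℂ) (v : Fin m → ℂ), v ≠ 0 → (A.map Complex.ofReal).mulVec v = z • v → 0 < z.re

theorem exists_eigenvector_of_mem_spectrum {m : ℕ} {C : Matrix (Fin m) (Fin m) ℂ} {μ : ℂ}
    (h : μ ∈ spectrum ℂ C) : ∃ v : Fin m → ℂ, v ≠ 0 ∧ C.mulVec v = μ • v := by
  rw [← Matrix.spectrum_toLin', ← Module.End.hasEigenvalue_iff_mem_spectrum] at h
  obtain ⟨v, hv⟩ := h.exists_hasEigenvector
  exact ⟨v, hv.2, by simpa using hv.apply_eq_smul⟩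

/-- If the eigenvalues of `A` have positive real part, `1 + A` is invertible. -/
theorem PosStable.isUnit_one_add {m : ℕ} {A : Matrix (Fin m) (Fin m) ℝ} (hA : PosStable A) :
    IsUnit (1 + A).det := by
  rw [isUnit_iff_ne_zero]
  intro h0
  obtain ⟨v, hv, hv0⟩ := Matrix.exists_mulVec_eq_zero_iff.2 h0
  have h1 : A.mulVec v = -v := by
    rw [Matrix.add_mulVec, Matrix.one_mulVec] at hv0
    exact eq_neg_of_add_eq_zero_right hv0
  have := hA (-1) (fun i => (v i : ℂ))
    (fun h => hv (funext fun i => by simpa using congrFun h i)) (by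
    ext i
    have := congrFun h1 i
    simp only [Matrix.mulVec, dotProduct, Matrix.map_apply, Pi.smul_apply, smul_eq_mul] at this ⊢
    rw [Pi.neg_apply] at this
    simp only [← Complex.ofReal_mul, ← Complex.ofReal_sum, this]
    simp)
  norm_num at this

/-- The Cayley transform of a matrix whose eigenvalues have positive real part. -/
noncomputable def cayley {m : ℕ} (A : Matrix (Fin m) (Fin m) ℝ) : Matrix (Fin m) (Fin m) ℝ :=
  (1 - A) * (1 + A)⁻¹

/-- The Cayley transform maps the right half plane to the unit disc. -/
theorem PosStable.norm_lt_one_of_mem_spectrum_cayley {m : ℕ} {A : Matrix (Fin m) (Fin m) ℝ}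
    (hA : PosStable A) {μ : ℂ} (hμ : μ ∈ spectrum ℂ ((cayley A).map Complex.ofReal)) :
    ‖μ‖ < 1 := by
  obtain ⟨v, hv, hCv⟩ := exists_eigenvector_of_mem_spectrum hμ
  set Ac := A.map Complex.ofReal with hAc
  set B := ((1 + A)⁻¹).map Complex.ofReal with hB
  have hmap : ∀ X Y : Matrix (Fin m) (Fin m) ℝ, (X * Y).map Complex.ofReal
      = X.map Complex.ofReal * Y.map Complex.ofReal :=
    fun X Y => Matrix.map_mul (f := Complex.ofRealHom)
  have h1 : (1 + A).map Complex.ofReal = 1 + Ac := by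
    ext i j; by_cases h : i = j <;> simp [h, hAc]
  have h2 : (1 - A).map Complex.ofReal = 1 - Ac := by
    ext i j; by_cases h : i = j <;> simp [h, hAc]
  have hinv : (1 + Ac) * B = 1 := by
    rw [← h1, ← hmap, Matrix.mul_nonsing_inv _ hA.isUnit_one_add]
    ext i j; by_cases h : i = j <;> simp [Matrix.one_apply, h]
  have hCe : (cayley A).map Complex.ofReal = (1 - Ac) * B := by rw [cayley, hmap, h2]
  set w := B.mulVec v with hw
  have hvw : v = (1 + Ac).mulVec w := by rw [hw, Matrix.mulVec_mulVec, hinv, Matrix.one_mulVec]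
  have hw0 : w ≠ 0 := fun h => hv (by rw [hvw, h, Matrix.mulVec_zero])
  have key : (1 - Ac).mulVec w = μ • (1 + Ac).mulVec w := by
    rw [← hvw, ← hCv, hCe, hw, Matrix.mulVec_mulVec]
  rw [Matrix.sub_mulVec, Matrix.add_mulVec, Matrix.one_mulVec] at key
  have key2 : (1 + μ) • Ac.mulVec w = (1 - μ) • w := by
    ext i
    have := congrFun key i
    simp only [Pi.sub_apply, Pi.smul_apply, Pi.add_apply, smul_eq_mul] at this ⊢
    linear_combination -this
  have hμ1 : 1 + μ ≠ 0 := by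
    intro h
    have h2 : (1 - μ) = 2 := by linear_combination -h
    rw [h, zero_smul, h2] at key2
    exact hw0 ((smul_eq_zero.1 key2.symm).resolve_left two_ne_zero)
  have hre := hA ((1 - μ) / (1 + μ)) w hw0 (by
    rw [div_eq_inv_mul, mul_smul, ← key2, smul_smul, inv_mul_cancel₀ hμ1, one_smul])
  rw [Complex.div_re, ← add_div] at hre
  have hpos : 0 < Complex.normSq (1 + μ) := Complex.normSq_pos.2 hμ1
  have hnum := (div_pos_iff_of_pos_right hpos).1 hre
  simp only [Complex.sub_re, Complex.one_re, Complex.add_re, Complex.sub_im, Complex.one_im,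
    Complex.add_im] at hnum
  have hsq : ‖μ‖ ^ 2 < 1 := by
    rw [Complex.sq_norm, Complex.normSq_apply]; nlinarith
  exact (sq_lt_one_iff₀ (norm_nonneg _)).1 hsq

theorem PosStable.tendsto_cayley_pow {m : ℕ} {A : Matrix (Fin m) (Fin m) ℝ} (hA : PosStable A) :
    Tendsto (fun k : ℕ => cayley A ^ k) atTop (𝓝 0) := by
  have h := tendsto_pow_zero_of_spectrum_lt_one ((cayley A).map Complex.ofReal)
    fun μ hμ => hA.norm_lt_one_of_mem_spectrum_cayley hμ
  have hp : ∀ k : ℕ, ((cayley A).map Complex.ofReal) ^ k = (cayley A ^ k).map Complex.ofReal :=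
    fun k => (Matrix.map_pow (cayley A) Complex.ofRealHom k).symm
  simp only [hp] at h
  have hre := ((Continuous.matrix_map continuous_id Complex.continuous_re).tendsto _).comp h
  have h0 : (0 : Matrix (Fin m) (Fin m) ℂ).map Complex.re = 0 := by ext i j; simp
  simp only [id, h0] at hre
  refine hre.congr fun k => ?_
  ext i j
  simp

/-- In terms of the Cayley transform the Lyapunov operator becomes a Stein operator. -/
theorem stein_of_lyapunov {m : ℕ} {A X Y : Matrix (Fin m) (Fin m) ℝ}
    (hA : IsUnit (1 + A).det) (h : A.transpose * X + X * A = Y) :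
    X = (cayley A).transpose * X * cayley A
      + (2 : ℝ) • (((1 + A)⁻¹).transpose * Y * (1 + A)⁻¹) := by
  set B := (1 + A)⁻¹ with hB
  have h1 : (1 + A) * B = 1 := Matrix.mul_nonsing_inv _ hA
  have h1t : B.transpose * (1 + A.transpose) = 1 := by
    have := congrArg Matrix.transpose h1
    simpa [Matrix.transpose_mul] using this
  have hid : (1 + A.transpose) * X * (1 + A)
      = (1 - A.transpose) * X * (1 - A) + (2 : ℝ) • Y := by
    rw [← h, two_smul]; noncomm_ring
  calc X = (B.transpose * (1 + A.transpose)) * X * ((1 + A) * B) := by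
        rw [h1, h1t, Matrix.one_mul, Matrix.mul_one]
    _ = B.transpose * ((1 + A.transpose) * X * (1 + A)) * B := by simp only [Matrix.mul_assoc]
    _ = _ := by
        rw [hid, cayley, ← hB, Matrix.transpose_mul, Matrix.transpose_sub, Matrix.transpose_one,
          Matrix.mul_add, Matrix.add_mul]
        simp only [Matrix.mul_assoc, Matrix.mul_smul, Matrix.smul_mul]

theorem PosStable.eq_zero_of_lyapunov_eq_zero {m : ℕ} {A X : Matrix (Fin m) (Fin m) ℝ}
    (hA : PosStable A) (h : A.transpose * X + X * A = 0) : X = 0 := by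
  have hs := stein_of_lyapunov hA.isUnit_one_add h
  simp only [Matrix.mul_zero, Matrix.zero_mul, smul_zero, add_zero] at hs
  have hk : ∀ k : ℕ, X = (cayley A ^ k).transpose * X * cayley A ^ k := by
    intro k
    induction k with
    | zero => simp
    | succ k ih =>
      conv_lhs => rw [hs]
      conv_lhs => rw [ih]
      rw [pow_succ, Matrix.transpose_mul]
      simp only [Matrix.mul_assoc]
  have hc := hA.tendsto_cayley_pow
  have hlim : Tendsto (fun k : ℕ => (cayley A ^ k).transpose * X * cayley A ^ k) atTop
      (𝓝 ((0 : Matrix (Fin m) (Fin m) ℝ).transpose * X * 0)) :=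
    ((((Continuous.matrix_transpose continuous_id).tendsto _).comp hc).mul
      tendsto_const_nhds).mul hc
  rw [Matrix.mul_zero] at hlim
  exact tendsto_nhds_unique (tendsto_const_nhds.congr hk) hlim

/-- **Lyapunov's theorem.** If the eigenvalues of `A` have positive real part, the Lyapunov
equation with a positive definite right-hand side has a positive definite solution. -/
theorem PosStable.exists_lyapunov {m : ℕ} {A Y : Matrix (Fin m) (Fin m) ℝ}
    (hA : PosStable A) (hY : Y.PosDef) :
    ∃ X : Matrix (Fin m) (Fin m) ℝ, X.PosDef ∧ A.transpose * X + X * A = Y := by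
  let F : Matrix (Fin m) (Fin m) ℝ →ₗ[ℝ] Matrix (Fin m) (Fin m) ℝ :=
    LinearMap.mulLeft ℝ A.transpose + LinearMap.mulRight ℝ A
  have hF : ∀ X, F X = A.transpose * X + X * A := fun X => by simp [F]
  have hinj : Function.Injective F := by
    rw [injective_iff_map_eq_zero]
    intro X hX
    exact hA.eq_zero_of_lyapunov_eq_zero (by rw [← hF, hX])
  obtain ⟨X, hX⟩ := (LinearMap.injective_iff_surjective.1 hinj) Y
  rw [hF] at hX
  have hYt : Y.transpose = Y := by
    simpa [Matrix.conjTranspose_eq_transpose_of_trivial] using hY.1.eq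
  have hXt : X.transpose = X := by
    apply hinj
    rw [hF, hF, hX]
    have := congrArg Matrix.transpose hX
    rw [hYt, Matrix.transpose_add, Matrix.transpose_mul, Matrix.transpose_mul,
      Matrix.transpose_transpose, add_comm] at this
    exact this
  refine ⟨X, ?_, hX⟩
  set C := cayley A with hC
  set W := (2 : ℝ) • (((1 + A)⁻¹).transpose * Y * (1 + A)⁻¹) with hW
  have hst : X = C.transpose * X * C + W := stein_of_lyapunov hA.isUnit_one_add hX
  have hinvu : Function.Injective ((1 + A)⁻¹).mulVec := by
    rw [Matrix.mulVec_injective_iff_isUnit, Matrix.isUnit_nonsing_inv_iff,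
      Matrix.isUnit_iff_isUnit_det]
    exact hA.isUnit_one_add
  have hq : ∀ v : Fin m → ℝ, v ⬝ᵥ X.mulVec v
      = C.mulVec v ⬝ᵥ X.mulVec (C.mulVec v) + v ⬝ᵥ W.mulVec v := by
    intro v
    conv_lhs => rw [hst]
    rw [Matrix.add_mulVec, dotProduct_add, ← Matrix.mulVec_mulVec, ← Matrix.mulVec_mulVec,
      Matrix.dotProduct_mulVec v C.transpose, Matrix.vecMul_transpose]
  have hWpos : W.PosDef := by
    rw [hW, ← Matrix.conjTranspose_eq_transpose_of_trivial]
    exact (hY.conjTranspose_mul_mul_same hinvu).smul two_pos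
  have hWd : ∀ v : Fin m → ℝ, 0 ≤ v ⬝ᵥ W.mulVec v := fun v => by
    simpa using hWpos.posSemidef.dotProduct_mulVec_nonneg v
  have hdec : ∀ (k : ℕ) (v : Fin m → ℝ),
      (C ^ k).mulVec v ⬝ᵥ X.mulVec ((C ^ k).mulVec v) ≤ v ⬝ᵥ X.mulVec v := by
    intro k v
    induction k with
    | zero => simp
    | succ k ih =>
      refine le_trans ?_ ih
      rw [hq ((C ^ k).mulVec v), pow_succ', ← Matrix.mulVec_mulVec]
      linarith [hWd ((C ^ k).mulVec v)]
  have hnn : ∀ v : Fin m → ℝ, 0 ≤ v ⬝ᵥ X.mulVec v := by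
    intro v
    have hcont : Continuous fun M : Matrix (Fin m) (Fin m) ℝ =>
        M.mulVec v ⬝ᵥ X.mulVec (M.mulVec v) := by
      fun_prop
    have hlim := (hcont.tendsto 0).comp hA.tendsto_cayley_pow
    simp only [Matrix.zero_mulVec, zero_dotProduct] at hlim
    exact le_of_tendsto hlim (Eventually.of_forall fun k => hdec k v)
  refine Matrix.PosDef.of_dotProduct_mulVec_pos ?_ fun v hv => ?_
  · rw [Matrix.IsHermitian, Matrix.conjTranspose_eq_transpose_of_trivial, hXt]
  · have h1 : 0 < v ⬝ᵥ W.mulVec v := by simpa using hWpos.dotProduct_mulVec_pos hv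
    rw [star_trivial, hq v]
    linarith [hnn (C.mulVec v)]

/-! ### The reduced Laplacian -/

/-- A matrix with orthonormal rows and one column more than rows which annihilates the constant
vectors has kernel exactly the constants, so the projection `1 - QᵀQ` onto its kernel has constant
columns. -/
theorem exists_one_sub_transpose_mul_apply {n : ℕ} (hn : 1 ≤ n)
    {Q : Matrix (Fin (n - 1)) (Fin n) ℝ} (hQ1 : Q.mulVec (fun _ => 1) = 0)
    (hQ : Q * Q.transpose = 1) :
    ∃ c : Fin n → ℝ, ∀ i j, (1 - Q.transpose * Q : Matrix (Fin n) (Fin n) ℝ) i j = c j := by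
  have hker : ∀ y : Fin n → ℝ, Q.mulVec y = 0 → ∃ c : ℝ, y = fun _ => c := by
    have hsurj : LinearMap.range Q.mulVecLin = ⊤ := by
      rw [LinearMap.range_eq_top]
      intro v
      exact ⟨Q.transpose.mulVec v, by simp [hQ]⟩
    have hfr : Module.finrank ℝ (LinearMap.ker Q.mulVecLin) = 1 := by
      have := Q.mulVecLin.finrank_range_add_finrank_ker
      rw [hsurj, finrank_top] at this
      simp only [Module.finrank_fintype_fun_eq_card, Fintype.card_fin] at this
      omega
    let one : LinearMap.ker Q.mulVecLin := ⟨fun _ => 1, by simpa using hQ1⟩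
    have hone : one ≠ 0 := fun h => by
      have h1 := congrFun (congrArg Subtype.val h) ⟨0, hn⟩
      simp [one] at h1
    intro y hy
    obtain ⟨c, hc⟩ := (finrank_eq_one_iff_of_nonzero' one hone).1 hfr ⟨y, by simpa using hy⟩
    refine ⟨c, ?_⟩
    have := congrArg Subtype.val hc
    funext i
    simpa [one] using (congrFun this i).symm
  have hcol : ∀ j, ∃ c : ℝ, (1 - Q.transpose * Q).mulVec (Pi.single j 1) = fun _ => c := fun j => by
    apply hker
    rw [Matrix.mulVec_mulVec, Matrix.mul_sub, ← Matrix.mul_assoc, hQ, Matrix.mul_one,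
      Matrix.one_mul, sub_self, Matrix.zero_mulVec]
  choose c hc using hcol
  refine ⟨c, fun i j => ?_⟩
  have := congrFun (hc j) i
  simpa using this

theorem laplacian_mulVec_apply {n : ℕ} {G : Digraph (Fin n)} (hloop : ∀ i, ¬ G.Adj i i)
    (x : Fin n → ℝ) (i : Fin n) :
    (laplacian G).mulVec x i = ∑ j ∈ nbrs G i, (x i - x j) := by
  classical
  have hA : ∀ y : Fin n → ℝ, ∑ j, adjacency G i j * y j = ∑ j ∈ nbrs G i, y j := fun y => by
    simp only [adjacency, nbrs, Matrix.of_apply, ite_mul, one_mul, zero_mul, Finset.sum_filter]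
  have hd : ∑ j ∈ Finset.univ.erase i, adjacency G i j = ∑ j, adjacency G i j := by
    apply Finset.sum_erase
    simp [adjacency, hloop i]
  have h1 := hA fun _ => x i
  rw [laplacian, Matrix.sub_mulVec, Pi.sub_apply, Matrix.mulVec_diagonal, hd, Finset.sum_mul, h1,
    Matrix.mulVec, dotProduct, hA, Finset.sum_sub_distrib]

/-- The Laplacian annihilates the constants, so it factors through the disagreement `Q x`. -/
theorem laplacian_mul_transpose_mul {n : ℕ} (hn : 1 ≤ n) {G : Digraph (Fin n)}
    (hloop : ∀ i, ¬ G.Adj i i)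
    {Q : Matrix (Fin (n - 1)) (Fin n) ℝ} (hQ1 : Q.mulVec (fun _ => 1) = 0)
    (hQ : Q * Q.transpose = 1) :
    laplacian G * (Q.transpose * Q) = laplacian G := by
  obtain ⟨c, hc⟩ := exists_one_sub_transpose_mul_apply hn hQ1 hQ
  have h0 : laplacian G * (1 - Q.transpose * Q) = 0 := by
    ext i j
    rw [Matrix.mul_apply]
    have := laplacian_mulVec_apply hloop (fun _ => c j) i
    simp only [Matrix.mulVec, dotProduct, sub_self, Finset.sum_const_zero] at this
    simpa only [hc, Matrix.zero_apply] using this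
  rw [Matrix.mul_sub, Matrix.mul_one, sub_eq_zero] at h0
  exact h0.symm

/-- If `L x ≥ 0`, the root carries the least value of `x`, since a minimum propagates along the
edges. -/
theorem root_le_of_laplacian_nonneg {n : ℕ} {G : Digraph (Fin n)} (hloop : ∀ i, ¬ G.Adj i i)
    {r : Fin n} (hr : ∀ i, Relation.ReflTransGen G.Adj i r) {x : Fin n → ℝ}
    (hx : ∀ i, 0 ≤ (laplacian G).mulVec x i) (i : Fin n) : x r ≤ x i := by
  obtain ⟨m, -, hm⟩ := Finset.exists_min_image Finset.univ x ⟨i, Finset.mem_univ i⟩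
  have hmin : ∀ k, Relation.ReflTransGen G.Adj m k → x k = x m := by
    intro k hk
    induction hk with
    | refl => rfl
    | @tail u w _ huw ih =>
      have hle : ∀ j ∈ nbrs G u, x u - x j ≤ 0 := fun j _ => by
        rw [ih]; linarith [hm j (Finset.mem_univ j)]
      have h0 : ∑ j ∈ nbrs G u, (x u - x j) = 0 :=
        le_antisymm (Finset.sum_nonpos hle) (by rw [← laplacian_mulVec_apply hloop]; exact hx u)
      have := (Finset.sum_eq_zero_iff_of_nonpos hle).1 h0 w (by simpa [nbrs] using huw)
      linarith
  rw [hmin r (hr m)]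
  exact hm i (Finset.mem_univ i)

/-- Over a digraph with a directed spanning tree, `L x` is constant for constant `x` only. -/
theorem eq_const_of_laplacian_mulVec_eq_const {n : ℕ} {G : Digraph (Fin n)}
    (hloop : ∀ i, ¬ G.Adj i i) {r : Fin n} (hr : ∀ i, Relation.ReflTransGen G.Adj i r)
    {x : Fin n → ℝ} {c : ℝ} (hx : (laplacian G).mulVec x = fun _ => c) (i : Fin n) :
    x i = x r := by
  wlog hc : 0 ≤ c generalizing x c
  · have := this (x := -x) (c := -c) (by rw [Matrix.mulVec_neg, hx]; rfl) (by linarith)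
    simpa using this
  have hxi : ∀ i, (laplacian G).mulVec x i = c := fun i => congrFun hx i
  have hlow := root_le_of_laplacian_nonneg hloop hr (x := x) fun i => by rw [hxi]; exact hc
  -- At a node with the least value of `x`, the Laplacian is nonpositive.
  have hc0 : c = 0 := le_antisymm (by
    rw [← hxi r, laplacian_mulVec_apply hloop]
    exact Finset.sum_nonpos fun j _ => by linarith [hlow j]) hc
  have hup := root_le_of_laplacian_nonneg hloop hr (x := -x) (fun i => by
    rw [Matrix.mulVec_neg, Pi.neg_apply, hxi, hc0, neg_zero]) i
  simp only [Pi.neg_apply] at hup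
  exact le_antisymm (by linarith) (hlow i)

theorem laplacian_map_mulVec_apply {n : ℕ} {G : Digraph (Fin n)} (hloop : ∀ i, ¬ G.Adj i i)
    (x : Fin n → ℂ) (i : Fin n) :
    ((laplacian G).map Complex.ofReal).mulVec x i = ∑ j ∈ nbrs G i, (x i - x j) := by
  apply Complex.ext
  · have := laplacian_mulVec_apply hloop (fun j => (x j).re) i
    simpa [Matrix.mulVec, dotProduct] using this
  · have := laplacian_mulVec_apply hloop (fun j => (x j).im) i
    simpa [Matrix.mulVec, dotProduct] using this

/-- By the maximum principle, an eigenvalue of the Laplacian in the closed left half plane is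
zero. -/
theorem eq_zero_of_laplacian_eigenvalue {n : ℕ} {G : Digraph (Fin n)} (hloop : ∀ i, ¬ G.Adj i i)
    {z : ℂ} {x : Fin n → ℂ} (hx0 : x ≠ 0)
    (hx : ((laplacian G).map Complex.ofReal).mulVec x = z • x) (hz : z.re ≤ 0) : z = 0 := by
  obtain ⟨i₀, hi₀⟩ := Function.ne_iff.1 hx0
  obtain ⟨m, -, hm⟩ := Finset.exists_max_image Finset.univ (fun i => ‖x i‖) ⟨i₀, Finset.mem_univ _⟩
  have hmpos : 0 < ‖x m‖ := lt_of_lt_of_le (norm_pos_iff.2 hi₀) (hm i₀ (Finset.mem_univ _))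
  have h1 : ((nbrs G m).card - z) * x m = ∑ j ∈ nbrs G m, x j := by
    have := congrFun hx m
    rw [laplacian_map_mulVec_apply hloop, Finset.sum_sub_distrib, Finset.sum_const,
      nsmul_eq_mul, Pi.smul_apply, smul_eq_mul] at this
    linear_combination this
  have h2 : ‖((nbrs G m).card - z : ℂ)‖ ≤ (nbrs G m).card := by
    have h3 : ‖((nbrs G m).card - z : ℂ)‖ * ‖x m‖ ≤ (nbrs G m).card * ‖x m‖ := by
      rw [← norm_mul, h1, ← nsmul_eq_mul]
      exact (norm_sum_le _ _).trans (Finset.sum_le_card_nsmul _ _ _ fun j _ =>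
        hm j (Finset.mem_univ _))
    exact le_of_mul_le_mul_right h3 hmpos
  have h4 : ‖((nbrs G m).card - z : ℂ)‖ ^ 2 ≤ ((nbrs G m).card : ℝ) ^ 2 := by gcongr
  rw [Complex.sq_norm, Complex.normSq_apply] at h4
  simp only [Complex.sub_re, Complex.natCast_re, Complex.sub_im, Complex.natCast_im] at h4
  have h5 : (0 : ℝ) ≤ (nbrs G m).card := Nat.cast_nonneg _
  have h6 : z.re * z.re + z.im * z.im ≤ 0 := by nlinarith [mul_nonneg h5 (neg_nonneg.2 hz)]
  exact Complex.ext (by simp; nlinarith [mul_self_nonneg z.re, mul_self_nonneg z.im])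
    (by simp; nlinarith [mul_self_nonneg z.re, mul_self_nonneg z.im])

/-- If the digraph contains a directed spanning tree, the eigenvalues of the reduced Laplacian
`Q L Qᵀ` have positive real part. -/
theorem posStable_reduced_laplacian {n : ℕ} (hn : 1 ≤ n) {G : Digraph (Fin n)}
    (hloop : ∀ i, ¬ G.Adj i i) (hG : HasDirectedSpanningTree G)
    {Q : Matrix (Fin (n - 1)) (Fin n) ℝ} (hQ1 : Q.mulVec (fun _ => 1) = 0)
    (hQ : Q * Q.transpose = 1) :
    PosStable (Q * laplacian G * Q.transpose) := by
  intro z v hv hev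
  by_contra! hz
  obtain ⟨r, hr⟩ := hG
  obtain ⟨c, hc⟩ := exists_one_sub_transpose_mul_apply hn hQ1 hQ
  have hmap : ∀ {k l m : ℕ} (X : Matrix (Fin k) (Fin l) ℝ) (Y : Matrix (Fin l) (Fin m) ℝ),
      (X * Y).map Complex.ofReal = X.map Complex.ofReal * Y.map Complex.ofReal :=
    fun X Y => Matrix.map_mul (f := Complex.ofRealHom)
  set Qc := Q.map Complex.ofReal with hQc
  set Qt := Q.transpose.map Complex.ofReal with hQt
  set Lc := (laplacian G).map Complex.ofReal with hLc
  have hQQ : Qc * Qt = 1 := by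
    rw [hQc, hQt, ← hmap, hQ]
    exact Matrix.map_one _ Complex.ofReal_zero Complex.ofReal_one
  have hQone : ∀ w : ℂ, Qc.mulVec (fun _ => w) = 0 := fun w => by
    ext i
    have := congrFun hQ1 i
    simp only [Matrix.mulVec, dotProduct, mul_one, Pi.zero_apply] at this
    simp only [hQc, Matrix.mulVec, dotProduct, Matrix.map_apply, Pi.zero_apply, ← Finset.sum_mul,
      ← Complex.ofReal_sum, this, Complex.ofReal_zero, zero_mul]
  have hkerQ : ∀ y : Fin n → ℂ, Qc.mulVec y = 0 → ∃ w, y = fun _ => w := by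
    intro y hy
    have h1 : y = ((1 - Q.transpose * Q).map Complex.ofReal).mulVec y := by
      have : (1 - Q.transpose * Q).map Complex.ofReal = 1 - Qt * Qc := by
        rw [hQt, hQc, ← hmap]; ext i j; by_cases h : i = j <;> simp [h]
      rw [this, Matrix.sub_mulVec, ← Matrix.mulVec_mulVec, hy]; simp
    exact ⟨∑ j, (c j : ℂ) * y j, h1.trans (funext fun i => by
      simp only [Matrix.mulVec, dotProduct, Matrix.map_apply, hc])⟩
  set x := Qt.mulVec v with hx
  have hQx : Qc.mulVec x = v := by rw [hx, Matrix.mulVec_mulVec, hQQ, Matrix.one_mulVec]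
  have hnotconst : ∀ w : ℂ, x ≠ fun _ => w := fun w h => hv (by rw [← hQx, h, hQone])
  obtain ⟨w, hw⟩ := hkerQ (Lc.mulVec x - z • x) (by
    rw [Matrix.mulVec_sub, Matrix.mulVec_smul, hQx, hx, Matrix.mulVec_mulVec, Matrix.mulVec_mulVec,
      ← hev, hmap, hmap, sub_self])
  have hLx : ∀ i, Lc.mulVec x i = z * x i + w := fun i => by
    have := congrFun hw i
    simp only [Pi.sub_apply, Pi.smul_apply, smul_eq_mul] at this
    linear_combination this
  by_cases hz0 : z = 0
  · have hre := eq_const_of_laplacian_mulVec_eq_const hloop hr (x := fun j => (x j).re) (c := w.re)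
      (by ext i; have := congrArg Complex.re (hLx i)
          simpa [hz0, hLc, Matrix.mulVec, dotProduct] using this)
    have him := eq_const_of_laplacian_mulVec_eq_const hloop hr (x := fun j => (x j).im) (c := w.im)
      (by ext i; have := congrArg Complex.im (hLx i)
          simpa [hz0, hLc, Matrix.mulVec, dotProduct] using this)
    exact hnotconst (x r) (funext fun i => Complex.ext (hre i) (him i))
  · -- Shifting `x` by a constant turns it into an eigenvector of the Laplacian.
    refine hz0 (eq_zero_of_laplacian_eigenvalue hloop (x := fun i => x i + w / z) ?_ ?_ hz)
    · intro h
      exact hnotconst (-(w / z)) (funext fun i => eq_neg_of_add_eq_zero_left (congrFun h i))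
    · ext i
      have h1 := hLx i
      rw [hLc, laplacian_map_mulVec_apply hloop] at h1
      rw [laplacian_map_mulVec_apply hloop, Pi.smul_apply, smul_eq_mul, mul_add,
        mul_div_cancel₀ _ hz0, ← h1]
      simp

/-! ### Extreme eigenvalues of symmetric matrices -/

theorem finite_spectrum {m : ℕ} {M : Matrix (Fin m) (Fin m) ℝ} (hM : M.IsHermitian) :
    (spectrum ℝ M).Finite := by
  rw [hM.spectrum_real_eq_range_eigenvalues]
  exact finite_range _

theorem lambdaMin_mul_norm_sq_le {m : ℕ} {M : Matrix (Fin m) (Fin m) ℝ} (hM : M.IsHermitian)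
    (x : EuclideanSpace ℝ (Fin m)) :
    lambdaMin M * ‖x‖ ^ 2 ≤ inner ℝ x (Matrix.toEuclideanCLM (𝕜 := ℝ) M x) := by
  have hps : (M - algebraMap ℝ _ (lambdaMin M)).PosSemidef := by
    rw [Matrix.posSemidef_iff_isHermitian_and_spectrum_nonneg]
    refine ⟨hM.sub (by simp [Matrix.IsHermitian, Matrix.algebraMap_eq_diagonal]), fun y hy => ?_⟩
    rw [← spectrum.sub_singleton_eq] at hy
    obtain ⟨z, hz, _, rfl, rfl⟩ := hy
    exact sub_nonneg.2 (csInf_le (finite_spectrum hM).bddBelow hz)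
  have h := hps.dotProduct_mulVec_nonneg x.ofLp
  rw [star_trivial, ← Matrix.inner_toEuclideanCLM, map_sub, AlgHomClass.commutes,
    sub_apply, inner_sub_right, Algebra.algebraMap_eq_smul_one,
    smul_apply, one_apply_eq_self, inner_smul_right,
    real_inner_self_eq_norm_sq] at h
  linarith

theorem inner_le_lambdaMax_mul_norm_sq {m : ℕ} {M : Matrix (Fin m) (Fin m) ℝ} (hM : M.IsHermitian)
    (x : EuclideanSpace ℝ (Fin m)) :
    inner ℝ x (Matrix.toEuclideanCLM (𝕜 := ℝ) M x) ≤ lambdaMax M * ‖x‖ ^ 2 := by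
  have hps : (algebraMap ℝ _ (lambdaMax M) - M).PosSemidef := by
    rw [Matrix.posSemidef_iff_isHermitian_and_spectrum_nonneg]
    refine ⟨Matrix.IsHermitian.sub (by simp [Matrix.IsHermitian, Matrix.algebraMap_eq_diagonal]) hM,
      fun y hy => ?_⟩
    rw [← spectrum.singleton_sub_eq] at hy
    obtain ⟨_, rfl, z, hz, rfl⟩ := hy
    exact sub_nonneg.2 (le_csSup (finite_spectrum hM).bddAbove hz)
  have h := hps.dotProduct_mulVec_nonneg x.ofLp
  rw [star_trivial, ← Matrix.inner_toEuclideanCLM, map_sub, AlgHomClass.commutes,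
    sub_apply, inner_sub_right, Algebra.algebraMap_eq_smul_one,
    smul_apply, one_apply_eq_self, inner_smul_right,
    real_inner_self_eq_norm_sq] at h
  linarith

theorem lambdaMin_pos {m : ℕ} [Nonempty (Fin m)] {M : Matrix (Fin m) (Fin m) ℝ} (hM : M.PosDef) :
    0 < lambdaMin M := by
  have hne : (spectrum ℝ M).Nonempty := by
    rw [hM.1.spectrum_real_eq_range_eigenvalues]; exact range_nonempty _
  have hmem : lambdaMin M ∈ spectrum ℝ M := hne.csInf_mem (finite_spectrum hM.1)
  rw [hM.1.spectrum_real_eq_range_eigenvalues] at hmem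
  obtain ⟨i, hi⟩ := hmem
  rw [← hi]
  exact hM.eigenvalues_pos i

theorem lambdaMax_pos {m : ℕ} [Nonempty (Fin m)] {M : Matrix (Fin m) (Fin m) ℝ} (hM : M.PosDef) :
    0 < lambdaMax M := by
  have hne : (spectrum ℝ M).Nonempty := by
    rw [hM.1.spectrum_real_eq_range_eigenvalues]; exact range_nonempty _
  obtain ⟨y, hy⟩ := hne
  exact (lambdaMin_pos hM).trans_le ((csInf_le (finite_spectrum hM.1).bddBelow hy).trans
    (le_csSup (finite_spectrum hM.1).bddAbove hy))

/-! ### The energy inequality -/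

section Energy

variable {E F : Type*} [NormedAddCommGroup E] [InnerProductSpace ℝ E] [NormedAddCommGroup F]
  [InnerProductSpace ℝ F]

/-- The Cauchy-Schwarz inequality for the form of a symmetric operator `0 ≤ P ≤ c`. -/
theorem inner_map_le_of_le {P : E →L[ℝ] E} {c : ℝ}
    (hsym : ∀ x y, inner ℝ (P x) y = inner ℝ x (P y)) (hpos : ∀ x, 0 ≤ inner ℝ x (P x))
    (hle : ∀ x, inner ℝ x (P x) ≤ c * ‖x‖ ^ 2) (x y : E) :
    inner ℝ (P x) y ≤ c * (‖x‖ * ‖y‖) := by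
  rcases eq_or_ne x 0 with rfl | hx
  · simp
  rcases eq_or_ne y 0 with rfl | hy
  · simp
  have hx' := norm_pos_iff.2 hx
  have hy' := norm_pos_iff.2 hy
  have h := hpos (‖y‖ • x - ‖x‖ • y)
  have h1 := hle x
  have h2 := hle y
  have hxy : inner ℝ x (P y) = inner ℝ (P x) y := (hsym x y).symm
  have hyx : inner ℝ y (P x) = inner ℝ (P x) y := real_inner_comm _ _
  simp only [map_sub, map_smul, inner_sub_left, inner_sub_right, inner_smul_left, inner_smul_right,
    hxy, hyx, conj_trivial] at h
  have h3 : 2 * (‖x‖ * ‖y‖) * inner ℝ (P x) y ≤ 2 * (‖x‖ * ‖y‖) * (c * (‖x‖ * ‖y‖)) := by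
    nlinarith [mul_le_mul_of_nonneg_left h1 (sq_nonneg ‖y‖),
      mul_le_mul_of_nonneg_left h2 (sq_nonneg ‖x‖)]
  exact le_of_mul_le_mul_left h3 (by positivity)

/-- For a large damping gain `b` the energy `V = ⟪χ, P χ⟫ + (β / 2) ‖z‖²` decays strictly faster
than `s²` does along `s' = - lam (s - θ U)`, `θ = (2 lmax + β) / (√μ lam)`, as long as
`√V ≥ θ U`. The damping of `z` absorbs all terms containing `z`, including a perturbation of `z` by
an arbitrary multiple `N U` of the bound `U` for the perturbation of `χ`. -/
theorem exists_gain_energy_decay {P A : E →L[ℝ] E} {B₁ : F →L[ℝ] E} {B₂ : F →L[ℝ] F}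
    {B₃ : E →L[ℝ] F} {lmin lmax β r lam : ℝ} (N : ℝ)
    (hsym : ∀ x y, inner ℝ (P x) y = inner ℝ x (P y))
    (hmin : ∀ x, lmin * ‖x‖ ^ 2 ≤ inner ℝ x (P x))
    (hmax : ∀ x, inner ℝ x (P x) ≤ lmax * ‖x‖ ^ 2)
    (hlmin : 0 < lmin) (hlmax : 0 < lmax) (hβ : 0 < β) (hlam : 0 < lam)
    (hlyap : ∀ x, 3 * lam * inner ℝ x (P x) ≤ 2 * r * inner ℝ (P x) (A x)) :
    ∃ b : ℝ, 0 < b ∧ ∀ (χ : E) (z : F) (f₁ : E) (f₂ : F) (U s : ℝ), 0 < U → ‖f₁‖ ≤ U →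
      ‖f₂‖ ≤ N * U → inner ℝ χ (P χ) + β / 2 * ‖z‖ ^ 2 = s ^ 2 →
      (2 * lmax + β) / (√(min lmin (β / 2)) * lam) * U ≤ s →
      2 * inner ℝ (P χ) (-(r • A χ) + B₁ z + f₁) + β * inner ℝ z (-(b • z) + B₂ z + B₃ χ + f₂)
        < -2 * lam * (s * (s - (2 * lmax + β) / (√(min lmin (β / 2)) * lam) * U)) := by
  set μ := min lmin (β / 2) with hμ
  have hμ0 : 0 < μ := lt_min hlmin (by positivity)
  have hsμ : 0 < √μ := Real.sqrt_pos.2 hμ0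
  set C := 2 * lmax + β with hC
  have hC0 : 0 < C := by positivity
  set θ := C / (√μ * lam) with hθ
  have hθ0 : 0 < θ := by positivity
  set c := C / √μ with hc
  have hc0 : 0 < c := by positivity
  have hcθ : lam * θ = c := by rw [hθ, hc]; field_simp
  set K₁ := 2 * lmax * ‖B₁‖ + β * ‖B₃‖ with hK₁
  set K₂ := β * ‖B₂‖ with hK₂
  set g := c * θ with hg
  have hg0 : 0 < g := by positivity
  set k₁ := K₁ ^ 2 / (4 * (lam * lmin)) with hk₁
  set k₂ := (β * N) ^ 2 / (2 * g) with hk₂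
  have hK₁0 : 0 ≤ K₁ := by positivity
  have hK₂0 : 0 ≤ K₂ := by positivity
  have hk₁0 : 0 ≤ k₁ := by positivity
  have hk₂0 : 0 ≤ k₂ := by positivity
  -- `β b` must outweigh the `z` part `lam β` of the decay rate, the coupling `K₂` of `z` with
  -- itself, and the `z` parts `k₁`, `k₂` of Young's inequality for the mixed terms.
  refine ⟨(K₂ + lam * β + k₁ + k₂) / β, by positivity, ?_⟩
  set b := (K₂ + lam * β + k₁ + k₂) / β with hb
  have hbβ : β * b = K₂ + lam * β + k₁ + k₂ := by rw [hb]; field_simp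
  clear_value b k₁ k₂ g K₁ K₂ θ c
  intro χ z f₁ f₂ U s hU hf₁ hf₂ hs hsU
  have hPpos : ∀ x, 0 ≤ inner ℝ x (P x) := fun x => le_trans (by positivity) (hmin x)
  have hCS := inner_map_le_of_le hsym hPpos hmax χ
  have hs0 : 0 ≤ s := le_trans (by positivity) hsU
  have e1 : inner ℝ (P χ) (B₁ z) ≤ lmax * (‖χ‖ * (‖B₁‖ * ‖z‖)) :=
    (hCS _).trans (by gcongr; exact B₁.le_opNorm z)
  have e2 : inner ℝ (P χ) f₁ ≤ lmax * (‖χ‖ * U) := (hCS _).trans (by gcongr)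
  have e3 : inner ℝ z (B₂ z) ≤ ‖z‖ * (‖B₂‖ * ‖z‖) :=
    (real_inner_le_norm _ _).trans (by gcongr; exact B₂.le_opNorm z)
  have e4 : inner ℝ z (B₃ χ) ≤ ‖z‖ * (‖B₃‖ * ‖χ‖) :=
    (real_inner_le_norm _ _).trans (by gcongr; exact B₃.le_opNorm χ)
  have e5 : inner ℝ z f₂ ≤ ‖z‖ * (N * U) := (real_inner_le_norm _ _).trans (by gcongr)
  have e6 := hlyap χ
  -- Young's inequality for the two mixed terms
  have y1 : K₁ * (‖χ‖ * ‖z‖) ≤ lam * lmin * ‖χ‖ ^ 2 + k₁ * ‖z‖ ^ 2 := by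
    have hll : 0 < lam * lmin := by positivity
    have : lam * lmin * ‖χ‖ ^ 2 + k₁ * ‖z‖ ^ 2 - K₁ * (‖χ‖ * ‖z‖)
        = (2 * (lam * lmin) * ‖χ‖ - K₁ * ‖z‖) ^ 2 / (4 * (lam * lmin)) := by
      rw [hk₁]; field_simp; ring
    have : 0 ≤ lam * lmin * ‖χ‖ ^ 2 + k₁ * ‖z‖ ^ 2 - K₁ * (‖χ‖ * ‖z‖) := by rw [this]; positivity
    linarith
  have y2 : β * N * (U * ‖z‖) ≤ g / 2 * U ^ 2 + k₂ * ‖z‖ ^ 2 := by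
    have : g / 2 * U ^ 2 + k₂ * ‖z‖ ^ 2 - β * N * (U * ‖z‖)
        = (g * U - β * N * ‖z‖) ^ 2 / (2 * g) := by
      rw [hk₂]; field_simp; ring
    have : 0 ≤ g / 2 * U ^ 2 + k₂ * ‖z‖ ^ 2 - β * N * (U * ‖z‖) := by rw [this]; positivity
    linarith
  have e7 : lam * lmin * ‖χ‖ ^ 2 ≤ lam * inner ℝ χ (P χ) := by
    rw [mul_assoc]; exact mul_le_mul_of_nonneg_left (hmin χ) hlam.le
  -- The margin `2 c s U` on the right-hand side pays with one half for the perturbation of `χ` and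
  -- with the other half for what Young's inequality leaves of the perturbation of `z`.
  have e8 : √μ * ‖χ‖ ≤ s := by
    have h1 : μ * ‖χ‖ ^ 2 ≤ s ^ 2 := by
      rw [← hs]
      have : μ * ‖χ‖ ^ 2 ≤ lmin * ‖χ‖ ^ 2 := by gcongr; exact min_le_left _ _
      have : 0 ≤ β / 2 * ‖z‖ ^ 2 := by positivity
      linarith [hmin χ]
    refine (abs_le_of_sq_le_sq' ?_ hs0).2
    rwa [mul_pow, Real.sq_sqrt hμ0.le]
  have e9 : 2 * lmax * (‖χ‖ * U) ≤ c * s * U := by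
    have h1 : C * ‖χ‖ ≤ c * s := by
      calc C * ‖χ‖ = c * (√μ * ‖χ‖) := by rw [hc]; field_simp
        _ ≤ c * s := by gcongr
    have h2 : 2 * lmax * ‖χ‖ ≤ C * ‖χ‖ := by gcongr; rw [hC]; linarith
    calc 2 * lmax * (‖χ‖ * U) = 2 * lmax * ‖χ‖ * U := by ring
      _ ≤ c * s * U := mul_le_mul_of_nonneg_right (h2.trans h1) hU.le
  have e10 : g * U ^ 2 ≤ c * s * U := by
    calc g * U ^ 2 = c * U * (θ * U) := by rw [hg]; ring
      _ ≤ c * U * s := mul_le_mul_of_nonneg_left hsU (mul_pos hc0 hU).le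
      _ = c * s * U := by ring
  have e11 : 0 < g * U ^ 2 := by positivity
  have hrhs : -2 * lam * (s * (s - θ * U)) = -2 * lam * s ^ 2 + 2 * (c * s * U) := by
    rw [← hcθ]; ring
  rw [hrhs, ← hs]
  simp only [inner_add_right, inner_neg_right, inner_smul_right, real_inner_self_eq_norm_sq]
  have hbz : β * b * ‖z‖ ^ 2 = (K₂ + lam * β + k₁ + k₂) * ‖z‖ ^ 2 := by rw [hbβ]
  have e3' := mul_le_mul_of_nonneg_left e3 hβ.le
  have e4' := mul_le_mul_of_nonneg_left e4 hβ.le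
  have e5' := mul_le_mul_of_nonneg_left e5 hβ.le
  have hK₁' : K₁ * (‖χ‖ * ‖z‖)
      = 2 * (lmax * (‖χ‖ * (‖B₁‖ * ‖z‖))) + β * (‖z‖ * (‖B₃‖ * ‖χ‖)) := by rw [hK₁]; ring
  have hK₂' : K₂ * ‖z‖ ^ 2 = β * (‖z‖ * (‖B₂‖ * ‖z‖)) := by rw [hK₂]; ring
  linarith

end Energy

/-- Comparison with `s' = - lam (s - w)`: if `V = s²` decays faster than `s²` wherever `s ≥ w`,
then `√V` is bounded by a solution of this equation. -/
theorem le_sq_of_deriv_lt {V V' : ℝ → ℝ} {t lam w W₀ : ℝ} (hw : 0 < w) (hW₀ : 0 ≤ W₀) (ht : 0 ≤ t)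
    (hcont : ContinuousOn V (Icc 0 t))
    (hderiv : ∀ τ ∈ Ico 0 t, HasDerivWithinAt V (V' τ) (Ici τ) τ) (h0 : V 0 ≤ W₀ ^ 2)
    (hlt : ∀ τ ∈ Ico 0 t, ∀ s, V τ = s ^ 2 → w ≤ s → V' τ < -2 * lam * (s * (s - w))) :
    V t ≤ (W₀ * Real.exp (-lam * t) + w) ^ 2 := by
  have hB : ∀ τ, HasDerivAt (fun τ => (W₀ * Real.exp (-lam * τ) + w) ^ 2)
      (2 * (W₀ * Real.exp (-lam * τ) + w) * (W₀ * (Real.exp (-lam * τ) * -lam))) τ := by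
    intro τ
    have h1 : HasDerivAt (fun τ => -lam * τ) (-lam) τ := by
      simpa using (hasDerivAt_id τ).const_mul (-lam)
    simpa only [Nat.cast_ofNat, Nat.add_one_sub_one, pow_one] using
      ((h1.exp.const_mul W₀).add_const w).fun_pow 2
  refine image_le_of_deriv_right_lt_deriv_boundary hcont hderiv ?_ hB ?_ (right_mem_Icc.2 ht)
  · simp only [mul_zero, Real.exp_zero, mul_one]
    exact h0.trans (by gcongr; linarith)
  · intro τ hτ hV
    have hp : 0 ≤ W₀ * Real.exp (-lam * τ) := by positivity
    have := hlt τ hτ _ hV (by linarith)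
    refine this.trans_eq ?_
    ring

/-! ### The closed loop in error coordinates -/

/-- A rectangular matrix as a continuous linear map between Euclidean spaces. -/
noncomputable def euclMap {m n : ℕ} (M : Matrix (Fin m) (Fin n) ℝ) :
    EuclideanSpace ℝ (Fin n) →L[ℝ] EuclideanSpace ℝ (Fin m) :=
  LinearMap.toContinuousLinearMap (Matrix.toLpLin 2 2 M)

theorem euclMap_toLp {m n : ℕ} (M : Matrix (Fin m) (Fin n) ℝ) (v : Fin n → ℝ) :
    euclMap M (WithLp.toLp 2 v) = WithLp.toLp 2 (M.mulVec v) := rfl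

theorem ofLp_euclMap {m n : ℕ} (M : Matrix (Fin m) (Fin n) ℝ) (v : EuclideanSpace ℝ (Fin n)) :
    (euclMap M v).ofLp = M.mulVec v.ofLp := rfl

theorem euclMap_mul {l m n : ℕ} (M : Matrix (Fin l) (Fin m) ℝ) (N : Matrix (Fin m) (Fin n) ℝ)
    (v : EuclideanSpace ℝ (Fin n)) : euclMap (M * N) v = euclMap M (euclMap N v) := by
  ext i
  simp only [ofLp_euclMap, Matrix.mulVec_mulVec]

theorem inner_euclMap {m n : ℕ} (M : Matrix (Fin m) (Fin n) ℝ) (v : EuclideanSpace ℝ (Fin n))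
    (w : EuclideanSpace ℝ (Fin m)) :
    inner ℝ w (euclMap M v) = inner ℝ (euclMap M.transpose w) v := by
  rw [EuclideanSpace.inner_eq_star_dotProduct, EuclideanSpace.inner_eq_star_dotProduct,
    ofLp_euclMap, ofLp_euclMap, star_trivial, star_trivial, Matrix.mulVec_transpose,
    dotProduct_comm, Matrix.dotProduct_mulVec, dotProduct_comm]

/-- A matrix with orthonormal rows is a contraction. -/
theorem norm_euclMap_le {m n : ℕ} {Q : Matrix (Fin m) (Fin n) ℝ} (hQ : Q * Q.transpose = 1)
    (v : EuclideanSpace ℝ (Fin n)) : ‖euclMap Q v‖ ≤ ‖v‖ := by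
  have hone : ∀ w : EuclideanSpace ℝ (Fin m), euclMap Q (euclMap Q.transpose w) = w := fun w => by
    rw [← euclMap_mul, hQ]; ext i; simp [ofLp_euclMap]
  have hiso : ∀ w : EuclideanSpace ℝ (Fin m), ‖euclMap Q.transpose w‖ ^ 2 = ‖w‖ ^ 2 := fun w => by
    rw [← real_inner_self_eq_norm_sq, ← inner_euclMap, hone, real_inner_self_eq_norm_sq]
  have hiso' : ∀ w : EuclideanSpace ℝ (Fin m), ‖euclMap Q.transpose w‖ = ‖w‖ := fun w =>
    (sq_eq_sq₀ (norm_nonneg _) (norm_nonneg _)).1 (hiso w)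
  have h : ‖euclMap Q v‖ ^ 2 ≤ ‖euclMap Q v‖ * ‖v‖ := by
    rw [← real_inner_self_eq_norm_sq, inner_euclMap]
    refine (real_inner_le_norm _ _).trans (by rw [hiso'])
  rcases (norm_nonneg (euclMap Q v)).eq_or_lt with h0 | h0
  · rw [← h0]; exact norm_nonneg _
  · rw [sq] at h; exact le_of_mul_le_mul_left h h0

theorem norm_toLp_le {n : ℕ} {v : Fin n → ℝ} {K : ℝ} (hK : 0 ≤ K) (hv : ∀ i, |v i| ≤ K) :
    ‖(WithLp.toLp 2 v : EuclideanSpace ℝ (Fin n))‖ ≤ √(n : ℝ) * K := by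
  rw [EuclideanSpace.norm_eq]
  refine Real.sqrt_le_iff.2 ⟨by positivity, ?_⟩
  rw [mul_pow, Real.sq_sqrt (Nat.cast_nonneg n)]
  calc ∑ i, ‖v i‖ ^ 2 ≤ ∑ _i : Fin n, K ^ 2 :=
        Finset.sum_le_sum fun i _ => by rw [Real.norm_eq_abs]; gcongr; exact hv i
    _ = n * K ^ 2 := by simp

theorem hasDerivWithinAt_toLp {n : ℕ} {f : Fin n → ℝ → ℝ} {f' : Fin n → ℝ} {s : Set ℝ} {t : ℝ}
    (h : ∀ i, HasDerivWithinAt (f i) (f' i) s t) :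
    HasDerivWithinAt (fun t => (WithLp.toLp 2 fun i => f i t : EuclideanSpace ℝ (Fin n)))
      (WithLp.toLp 2 f') s t :=
  ((PiLp.continuousLinearEquiv 2 ℝ fun _ : Fin n => ℝ).symm.toContinuousLinearMap.hasFDerivAt
    |>.comp_hasDerivWithinAt t (hasDerivWithinAt_pi.2 h))

theorem threshold_pos {c₁ c₂ : ℝ} (hc₁ : 0 < c₁) (hc₂ : 0 ≤ c₂) (c₃ t : ℝ) :
    0 < threshold c₁ c₂ c₃ t := by
  rw [threshold]; positivity

theorem threshold_le {c₁ c₂ c₃ t : ℝ} (hc₂ : 0 ≤ c₂) (hc₃ : 0 ≤ c₃) (ht : 0 ≤ t) :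
    threshold c₁ c₂ c₃ t ≤ c₁ + c₂ := by
  have : Real.exp (-c₃ * t) ≤ 1 := Real.exp_le_one_iff.2 (by nlinarith)
  rw [threshold]
  nlinarith

namespace Run

variable {n : ℕ} (x : Run n)

/-- The coordination states as a vector. -/
noncomputable def gammaVec (t : ℝ) : EuclideanSpace ℝ (Fin n) := WithLp.toLp 2 fun i => x.γ i t

/-- The deviation of the rates from the desired pace. -/
noncomputable def paceError (t : ℝ) : EuclideanSpace ℝ (Fin n) :=
  WithLp.toLp 2 fun i => x.dγ i t - x.dγd t

/-- The upper part `b Q γ + Q (dγ - dγd 1)` of `S ξ_TC`. -/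
noncomputable def chi (Q : Matrix (Fin (n - 1)) (Fin n) ℝ) (b t : ℝ) :
    EuclideanSpace ℝ (Fin (n - 1)) :=
  b • euclMap Q (x.gammaVec t) + euclMap Q (x.paceError t)

/-- The perturbation by the estimation and path-following errors. -/
noncomputable def forcing (G : Digraph (Fin n)) (a kPF η t : ℝ) : EuclideanSpace ℝ (Fin n) :=
  WithLp.toLp 2 fun i => a * ∑ j ∈ nbrs G i, x.e j t + x.alphaBar kPF η i t

/-- The rate of `dγ - dγd 1` that is due to perturbations, including the change of the desired
pace. -/
noncomputable def forcingPace (G : Digraph (Fin n)) (a kPF η t : ℝ) : EuclideanSpace ℝ (Fin n) :=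
  x.forcing G a kPF η t + WithLp.toLp 2 fun _ => -x.ddγd t

theorem abs_alphaBar_le {kPF η : ℝ} (hk : 0 ≤ kPF) (hη : 0 < η) (i : Fin n) (t : ℝ) :
    |x.alphaBar kPF η i t| ≤ kPF * ‖x.ePFi i t‖ := by
  have hpos : 0 < ‖x.vel i t‖ + η := by positivity
  rw [alphaBar, abs_mul, abs_of_nonneg hk, abs_div, abs_of_pos hpos]
  refine mul_le_mul_of_nonneg_left ?_ hk
  rw [div_le_iff₀ hpos]
  refine (abs_real_inner_le_norm _ _).trans ?_
  rw [mul_comm]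
  gcongr
  linarith

theorem abs_sum_e_le {G : Digraph (Fin n)} {t H : ℝ} (hH : 0 ≤ H) (he : ∀ j, |x.e j t| ≤ H)
    (i : Fin n) : |∑ j ∈ nbrs G i, x.e j t| ≤ n * H := by
  calc |∑ j ∈ nbrs G i, x.e j t| ≤ ∑ j ∈ nbrs G i, |x.e j t| := Finset.abs_sum_le_sum_abs _ _
    _ ≤ (nbrs G i).card • H := Finset.sum_le_card_nsmul _ _ _ fun j _ => he j
    _ ≤ n * H := by
      rw [nsmul_eq_mul]
      gcongr
      simpa using Finset.card_le_univ (nbrs G i)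

theorem norm_forcing_le {G : Digraph (Fin n)} {a kPF η t H : ℝ} (ha : 0 ≤ a) (hk : 0 ≤ kPF)
    (hη : 0 < η) (hH : 0 ≤ H) (he : ∀ j, |x.e j t| ≤ H) :
    ‖x.forcing G a kPF η t‖ ≤ a * n * √(n : ℝ) * H + kPF * ‖x.ePF t‖ := by
  have h1 : ‖(WithLp.toLp 2 fun i => a * ∑ j ∈ nbrs G i, x.e j t : EuclideanSpace ℝ (Fin n))‖
      ≤ √(n : ℝ) * (a * (n * H)) :=
    norm_toLp_le (by positivity) fun i => by
      rw [abs_mul, abs_of_nonneg ha]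
      exact mul_le_mul_of_nonneg_left (x.abs_sum_e_le hH he i) ha
  have h2 : ‖(WithLp.toLp 2 fun i => x.alphaBar kPF η i t : EuclideanSpace ℝ (Fin n))‖
      ≤ kPF * ‖x.ePF t‖ := by
    rw [EuclideanSpace.norm_eq]
    refine Real.sqrt_le_iff.2 ⟨by positivity, ?_⟩
    rw [mul_pow, PiLp.norm_sq_eq_of_L2, Finset.mul_sum]
    refine Finset.sum_le_sum fun i _ => ?_
    rw [Real.norm_eq_abs, ← mul_pow]
    exact pow_le_pow_left₀ (abs_nonneg _) (x.abs_alphaBar_le hk hη i t) 2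
  calc ‖x.forcing G a kPF η t‖
      = ‖(WithLp.toLp 2 fun i => a * ∑ j ∈ nbrs G i, x.e j t : EuclideanSpace ℝ (Fin n))
        + WithLp.toLp 2 fun i => x.alphaBar kPF η i t‖ := rfl
    _ ≤ _ := (norm_add_le _ _).trans (add_le_add h1 h2)
    _ = _ := by ring

theorem norm_forcingPace_le {G : Digraph (Fin n)} {a kPF η t H : ℝ} (ha : 0 ≤ a) (hk : 0 ≤ kPF)
    (hη : 0 < η) (hn : 1 ≤ n) (hH : 0 ≤ H) (he : ∀ j, |x.e j t| ≤ H) :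
    ‖x.forcingPace G a kPF η t‖
      ≤ √(n : ℝ) * (a * n * √(n : ℝ) * H + kPF * ‖x.ePF t‖ + |x.ddγd t|) := by
  have h1 := x.norm_forcing_le (G := G) ha hk hη hH he
  have h2 : ‖(WithLp.toLp 2 fun _ => -x.ddγd t : EuclideanSpace ℝ (Fin n))‖
      ≤ √(n : ℝ) * |x.ddγd t| := norm_toLp_le (abs_nonneg _) fun i => by rw [abs_neg]
  have h3 : 1 ≤ √(n : ℝ) := Real.one_le_sqrt.2 (by exact_mod_cast hn)
  have h4 : 0 ≤ a * n * √(n : ℝ) * H + kPF * ‖x.ePF t‖ := by positivity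
  calc ‖x.forcingPace G a kPF η t‖ ≤ _ := norm_add_le _ _
    _ ≤ 1 * (a * n * √(n : ℝ) * H + kPF * ‖x.ePF t‖) + √(n : ℝ) * |x.ddγd t| := by linarith
    _ ≤ √(n : ℝ) * (a * n * √(n : ℝ) * H + kPF * ‖x.ePF t‖) + √(n : ℝ) * |x.ddγd t| := by gcongr
    _ = _ := by ring

theorem mem_times_of_le {t τ : ℝ} (ht : t ∈ x.times) (h0 : 0 ≤ τ) (h : τ ≤ t) : τ ∈ x.times :=
  ⟨h0, lt_of_le_of_lt (EReal.coe_le_coe_iff.2 h) ht.2⟩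

variable {x} {G : Digraph (Fin n)} {a b kPF η : ℝ} {h : ℝ → ℝ}

theorem IsClosedLoop.zero_mem_times (hx : x.IsClosedLoop G a b kPF η h) : (0 : ℝ) ∈ x.times :=
  ⟨le_rfl, hx.T_pos⟩

theorem IsClosedLoop.hasDerivWithinAt_gammaVec (hx : x.IsClosedLoop G a b kPF η h) {t : ℝ}
    (ht : t ∈ x.times) :
    HasDerivWithinAt x.gammaVec (x.paceError t + WithLp.toLp 2 fun _ => x.dγd t) (Ici 0) t := by
  refine (hasDerivWithinAt_toLp fun i => hx.γ_deriv i t ht).congr_deriv ?_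
  ext i
  simp [paceError]

/-- The control law in vector form. -/
theorem IsClosedLoop.hasDerivWithinAt_paceError (hloop : ∀ i, ¬ G.Adj i i)
    (hx : x.IsClosedLoop G a b kPF η h) {t : ℝ} (ht : t ∈ x.times) :
    HasDerivWithinAt x.paceError (-(b • x.paceError t) - a • euclMap (laplacian G) (x.gammaVec t)
      + x.forcingPace G a kPF η t) (Ici t) t := by
  have := hasDerivWithinAt_toLp fun i => (hx.control i t ht).sub
    ((hx.dγd_deriv t ht).mono (Ici_subset_Ici.2 ht.1))
  refine this.congr_deriv ?_
  ext i
  simp only [paceError, gammaVec, forcingPace, forcing, euclMap_toLp, PiLp.add_apply,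
    PiLp.sub_apply, PiLp.neg_apply, PiLp.smul_apply, smul_eq_mul, laplacian_mulVec_apply hloop]
  have hs : ∑ j ∈ nbrs G i, (x.γ i t - x.γhat j t)
      = ∑ j ∈ nbrs G i, (x.γ i t - x.γ j t) - ∑ j ∈ nbrs G i, x.e j t := by
    rw [← Finset.sum_sub_distrib]
    exact Finset.sum_congr rfl fun j _ => by rw [e]; ring
  rw [hs]
  ring

theorem IsClosedLoop.continuousOn_gammaVec (hx : x.IsClosedLoop G a b kPF η h) :
    ContinuousOn x.gammaVec x.times := fun _ ht =>
  (hx.hasDerivWithinAt_gammaVec ht).continuousWithinAt.mono fun _ hs => hs.1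

theorem IsClosedLoop.continuousOn_paceError (hx : x.IsClosedLoop G a b kPF η h) :
    ContinuousOn x.paceError x.times := by
  refine (PiLp.continuous_toLp 2 fun _ : Fin n => ℝ).comp_continuousOn
    (continuousOn_pi.2 fun i => (hx.dγ_cont i).sub fun t ht => ?_)
  exact (hx.dγd_deriv t ht).continuousWithinAt.mono fun _ hs => hs.1

variable {Q : Matrix (Fin (n - 1)) (Fin n) ℝ}

theorem euclMap_const (hQ1 : Q.mulVec (fun _ => 1) = 0) (c : ℝ) :
    euclMap Q (WithLp.toLp 2 fun _ => c) = 0 := by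
  have : (fun _ : Fin n => c) = c • fun _ => (1 : ℝ) := by ext; simp
  rw [this, euclMap_toLp, Matrix.mulVec_smul, hQ1, smul_zero, WithLp.toLp_zero]

/-- The Laplacian factors through the disagreement `Q γ`, which is a combination of `χ` and the pace
error. -/
theorem smul_euclMap_laplacian (hn : 1 ≤ n) (hloop : ∀ i, ¬ G.Adj i i)
    (hQ1 : Q.mulVec (fun _ => 1) = 0) (hQ : Q * Q.transpose = 1) (t : ℝ) :
    b • euclMap (laplacian G) (x.gammaVec t) = euclMap (laplacian G * Q.transpose) (x.chi Q b t)
      - euclMap (laplacian G) (x.paceError t) := by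
  have h1 := laplacian_mul_transpose_mul hn hloop hQ1 hQ
  rw [chi, map_add, map_smul, ← euclMap_mul, ← euclMap_mul, Matrix.mul_assoc, h1,
    add_sub_cancel_right]

theorem IsClosedLoop.hasDerivWithinAt_paceError' (hn : 1 ≤ n) (hloop : ∀ i, ¬ G.Adj i i)
    (hQ1 : Q.mulVec (fun _ => 1) = 0) (hQ : Q * Q.transpose = 1) {r : ℝ}
    (hx : x.IsClosedLoop G (r * b) b kPF η h) {t : ℝ} (ht : t ∈ x.times) :
    HasDerivWithinAt x.paceError (-(b • x.paceError t) + (r • euclMap (laplacian G)) (x.paceError t)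
      + (-(r • euclMap (laplacian G * Q.transpose))) (x.chi Q b t)
      + x.forcingPace G (r * b) kPF η t) (Ici t) t := by
  refine (hx.hasDerivWithinAt_paceError hloop ht).congr_deriv ?_
  rw [mul_smul, smul_euclMap_laplacian hn hloop hQ1 hQ, neg_apply, smul_apply, smul_apply, smul_sub]
  abel

/-- The change of the desired pace does not affect `χ`, since `Q` annihilates the constants. -/
theorem IsClosedLoop.hasDerivWithinAt_chi (hn : 1 ≤ n) (hloop : ∀ i, ¬ G.Adj i i)
    (hQ1 : Q.mulVec (fun _ => 1) = 0) (hQ : Q * Q.transpose = 1) {r : ℝ}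
    (hx : x.IsClosedLoop G (r * b) b kPF η h) {t : ℝ} (ht : t ∈ x.times) :
    HasDerivWithinAt (x.chi Q b)
      (-(r • Matrix.toEuclideanCLM (𝕜 := ℝ) (Q * laplacian G * Q.transpose) (x.chi Q b t))
        + (r • euclMap (Q * laplacian G)) (x.paceError t)
        + euclMap Q (x.forcing G (r * b) kPF η t)) (Ici t) t := by
  have h1 := (euclMap Q).hasFDerivAt.comp_hasDerivWithinAt t
    ((hx.hasDerivWithinAt_gammaVec ht).mono (Ici_subset_Ici.2 ht.1))
  have h2 := (euclMap Q).hasFDerivAt.comp_hasDerivWithinAt t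
    (hx.hasDerivWithinAt_paceError' hn hloop hQ1 hQ ht)
  refine ((h1.const_smul b).add h2).congr_deriv ?_
  have h3 : Matrix.toEuclideanCLM (𝕜 := ℝ) (Q * laplacian G * Q.transpose) (x.chi Q b t)
      = euclMap Q (euclMap (laplacian G * Q.transpose) (x.chi Q b t)) := by
    rw [← euclMap_mul, ← Matrix.mul_assoc]; rfl
  rw [h3, forcingPace]
  simp only [map_add, map_neg, map_smul, euclMap_const hQ1, neg_apply, smul_apply, euclMap_mul,
    add_zero]
  abel

theorem toEuclideanCLM_Smat_xiTC (t : ℝ) :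
    Matrix.toEuclideanCLM (𝕜 := ℝ) (Smat Q b) (x.xiTC Q t)
      = WithLp.toLp 2 (Sum.elim (x.chi Q b t).ofLp (x.paceError t).ofLp) := by
  rw [xiTC, Matrix.toEuclideanCLM_toLp, Smat, Matrix.fromBlocks_mulVec]
  congr 1
  ext i
  cases i <;> simp [chi, gammaVec, paceError, euclMap_toLp, Matrix.smul_mulVec]

theorem norm_sq_toLp_sumElim {m : ℕ} (u : EuclideanSpace ℝ (Fin m)) (v : EuclideanSpace ℝ (Fin n)) :
    ‖(WithLp.toLp 2 (Sum.elim u.ofLp v.ofLp) : EuclideanSpace ℝ (Fin m ⊕ Fin n))‖ ^ 2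
      = ‖u‖ ^ 2 + ‖v‖ ^ 2 := by
  simp [EuclideanSpace.norm_sq_eq, Fintype.sum_sum_type]

theorem isUnit_det_Smat (hb : b ≠ 0) : IsUnit (Smat Q b).det := by
  rw [Smat, Matrix.det_fromBlocks_zero₂₁, Matrix.det_smul]
  simp [hb]

theorem norm_xiTC_le (hb : b ≠ 0) (t : ℝ) :
    ‖x.xiTC Q t‖ ≤ opNorm (Smat Q b)⁻¹ * √(‖x.chi Q b t‖ ^ 2 + ‖x.paceError t‖ ^ 2) := by
  have h1 : x.xiTC Q t = Matrix.toEuclideanCLM (𝕜 := ℝ) (Smat Q b)⁻¹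
      (Matrix.toEuclideanCLM (𝕜 := ℝ) (Smat Q b) (x.xiTC Q t)) := by
    rw [← mul_apply_eq_comp, ← map_mul, Matrix.nonsing_inv_mul _ (isUnit_det_Smat hb), map_one]
    rfl
  have h2 := (Matrix.toEuclideanCLM (𝕜 := ℝ) (Smat Q b)⁻¹).le_opNorm
    (Matrix.toEuclideanCLM (𝕜 := ℝ) (Smat Q b) (x.xiTC Q t))
  rw [← h1, toEuclideanCLM_Smat_xiTC] at h2
  rwa [← norm_sq_toLp_sumElim, Real.sqrt_sq (norm_nonneg _)]

theorem sqrt_chi_le (t : ℝ) :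
    √(‖x.chi Q b t‖ ^ 2 + ‖x.paceError t‖ ^ 2) ≤ opNorm (Smat Q b) * ‖x.xiTC Q t‖ := by
  have h2 := (Matrix.toEuclideanCLM (𝕜 := ℝ) (Smat Q b)).le_opNorm (x.xiTC Q t)
  rw [toEuclideanCLM_Smat_xiTC] at h2
  rwa [← norm_sq_toLp_sumElim, Real.sqrt_sq (norm_nonneg _)]

end Run

/-! ### Exponential convergence of the coordination error -/

/-- The Lyapunov equation and the bound on the rate `lam` give the decay of the form of `Ψ`. -/
theorem mul_inner_le_of_lyapunov {m : ℕ} [Nonempty (Fin m)] {A Ψ Ξ : Matrix (Fin m) (Fin m) ℝ}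
    (hΨ : Ψ.PosDef) (hΞ : Ξ.PosDef) (hlyap : A.transpose * Ψ + Ψ * A = Ξ) {r lam : ℝ} (hr : 0 < r)
    (hlam : 0 < lam) (hle : lam ≤ r * (lambdaMin Ξ / (3 * lambdaMax Ψ)))
    (v : EuclideanSpace ℝ (Fin m)) :
    3 * lam * inner ℝ v (Matrix.toEuclideanCLM (𝕜 := ℝ) Ψ v)
      ≤ 2 * r * inner ℝ (Matrix.toEuclideanCLM (𝕜 := ℝ) Ψ v)
        (Matrix.toEuclideanCLM (𝕜 := ℝ) A v) := by
  have hmax := lambdaMax_pos hΨ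
  have hsym : Ψ.transpose = Ψ := by
    simpa [Matrix.conjTranspose_eq_transpose_of_trivial] using hΨ.1.eq
  have h1 : inner ℝ v (Matrix.toEuclideanCLM (𝕜 := ℝ) Ξ v)
      = 2 * inner ℝ (Matrix.toEuclideanCLM (𝕜 := ℝ) Ψ v) (Matrix.toEuclideanCLM (𝕜 := ℝ) A v) := by
    have e1 : inner ℝ v (euclMap (Ψ * A) v) = inner ℝ (euclMap Ψ v) (euclMap A v) := by
      rw [euclMap_mul, inner_euclMap, hsym]
    have e2 : inner ℝ v (euclMap (A.transpose * Ψ) v) = inner ℝ (euclMap Ψ v) (euclMap A v) := by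
      rw [euclMap_mul, inner_euclMap, Matrix.transpose_transpose, real_inner_comm]
    calc inner ℝ v (Matrix.toEuclideanCLM (𝕜 := ℝ) Ξ v)
        = inner ℝ v (euclMap (A.transpose * Ψ) v + euclMap (Ψ * A) v) := by
          rw [← hlyap, map_add]; rfl
      _ = 2 * inner ℝ (euclMap Ψ v) (euclMap A v) := by rw [inner_add_right, e1, e2]; ring
  have h2 := lambdaMin_mul_norm_sq_le hΞ.1 v
  have h3 := inner_le_lambdaMax_mul_norm_sq hΨ.1 v
  have h4 : 3 * lam * lambdaMax Ψ ≤ r * lambdaMin Ξ := by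
    rw [← mul_div_assoc, le_div_iff₀ (by positivity)] at hle
    linarith
  calc 3 * lam * inner ℝ v (Matrix.toEuclideanCLM (𝕜 := ℝ) Ψ v)
      ≤ 3 * lam * (lambdaMax Ψ * ‖v‖ ^ 2) := by gcongr
    _ = 3 * lam * lambdaMax Ψ * ‖v‖ ^ 2 := by ring
    _ ≤ r * lambdaMin Ξ * ‖v‖ ^ 2 := by gcongr
    _ = r * (lambdaMin Ξ * ‖v‖ ^ 2) := by ring
    _ ≤ r * inner ℝ v (Matrix.toEuclideanCLM (𝕜 := ℝ) Ξ v) := by gcongr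
    _ = _ := by rw [h1]; ring

/-- For suitable gains `a = r b` the coordination error decays exponentially, up to a multiple of
any bound `U` for the perturbations. -/
theorem exists_gain_norm_xiTC_le {n : ℕ} (hn : 2 ≤ n) {G : Digraph (Fin n)}
    (hloop : ∀ i, ¬ G.Adj i i)
    {Q : Matrix (Fin (n - 1)) (Fin n) ℝ} (hQ1 : Q.mulVec (fun _ => 1) = 0)
    (hQ : Q * Q.transpose = 1) {Ψ Ξ : Matrix (Fin (n - 1)) (Fin (n - 1)) ℝ}
    (hΨ : Ψ.PosDef) (hΞ : Ξ.PosDef)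
    (hlyap : (Q * laplacian G * Q.transpose).transpose * Ψ
      + Ψ * (Q * laplacian G * Q.transpose) = Ξ) {β r lam : ℝ} (hβ : 0 < β) (hr : 0 < r)
    (hlam : 0 < lam) (hle : lam ≤ r * (lambdaMin Ξ / (3 * lambdaMax Ψ))) :
    ∃ b : ℝ, 0 < b ∧ ∀ (kPF η : ℝ) (h : ℝ → ℝ), 0 < kPF → 0 < η → (∀ t, 0 ≤ h t) →
      ∀ x : Run n, x.IsClosedLoop G (r * b) b kPF η h → ∀ U : ℝ, 0 < U →
        (∀ t ∈ x.times, r * b * n * √(n : ℝ) * h t + kPF * ‖x.ePF t‖ + |x.ddγd t| ≤ U) →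
        ∀ t ∈ x.times, ‖x.xiTC Q t‖ ≤ kappa1 Q Ψ β b * ‖x.xiTC Q 0‖ * Real.exp (-lam * t)
          + kappa2 Q Ψ β b lam * U := by
  have : Nonempty (Fin (n - 1)) := ⟨⟨0, by omega⟩⟩
  have hsymΨ : Ψ.transpose = Ψ := by
    simpa [Matrix.conjTranspose_eq_transpose_of_trivial] using hΨ.1.eq
  have hlmin := lambdaMin_pos hΨ
  have hlmax := lambdaMax_pos hΨ
  set P := Matrix.toEuclideanCLM (𝕜 := ℝ) Ψ with hP
  have hsym : ∀ v w, inner ℝ (P v) w = inner ℝ v (P w) := fun v w => by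
    have : inner ℝ v (euclMap Ψ w) = inner ℝ (euclMap Ψ v) w := by rw [inner_euclMap, hsymΨ]
    exact this.symm
  obtain ⟨b, hb, hdecay⟩ := exists_gain_energy_decay (P := P)
    (A := Matrix.toEuclideanCLM (𝕜 := ℝ) (Q * laplacian G * Q.transpose))
    (B₁ := r • euclMap (Q * laplacian G)) (B₂ := r • euclMap (laplacian G))
    (B₃ := -(r • euclMap (laplacian G * Q.transpose))) (√(n : ℝ)) hsym
    (lambdaMin_mul_norm_sq_le hΨ.1) (inner_le_lambdaMax_mul_norm_sq hΨ.1) hlmin hlmax hβ hlam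
    (mul_inner_le_of_lyapunov hΨ hΞ hlyap hr hlam hle)
  refine ⟨b, hb, fun kPF η h hk hη hh x hx U hU hbound t ht => ?_⟩
  have ha : 0 < r * b := mul_pos hr hb
  have hn1 : 1 ≤ n := by omega
  have hmem : ∀ τ ∈ Icc 0 t, τ ∈ x.times := fun τ hτ => x.mem_times_of_le ht hτ.1 hτ.2
  set μ := min (lambdaMin Ψ) (β / 2) with hμ
  set M := max (lambdaMax Ψ) (β / 2) with hM
  set θ := (2 * lambdaMax Ψ + β) / (√μ * lam) with hθ
  have hμ0 : 0 < μ := lt_min hlmin (by positivity)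
  have hM0 : 0 < M := lt_of_lt_of_le hlmax (le_max_left _ _)
  have hμM : μ ≤ M := (min_le_right _ _).trans (le_max_right _ _)
  have hsμ : 0 < √μ := Real.sqrt_pos.2 hμ0
  have hθ0 : 0 < θ := by positivity
  have hS0 : 0 ≤ opNorm (Smat Q b) := norm_nonneg _
  have hSi0 : 0 ≤ opNorm (Smat Q b)⁻¹ := norm_nonneg _
  set V : ℝ → ℝ := fun τ => inner ℝ (x.chi Q b τ) (P (x.chi Q b τ)) + β / 2 * ‖x.paceError τ‖ ^ 2
    with hV
  have hVlow : ∀ τ, μ * (‖x.chi Q b τ‖ ^ 2 + ‖x.paceError τ‖ ^ 2) ≤ V τ := fun τ => by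
    rw [mul_add]
    refine add_le_add (le_trans ?_ (lambdaMin_mul_norm_sq_le hΨ.1 _)) ?_
    · gcongr; exact min_le_left _ _
    · gcongr; exact min_le_right _ _
  have hVup : ∀ τ, V τ ≤ M * (‖x.chi Q b τ‖ ^ 2 + ‖x.paceError τ‖ ^ 2) := fun τ => by
    rw [mul_add]
    refine add_le_add ((inner_le_lambdaMax_mul_norm_sq hΨ.1 _).trans ?_) ?_
    · gcongr; exact le_max_left _ _
    · gcongr; exact le_max_right _ _
  have hcz : ContinuousOn x.paceError (Icc 0 t) := hx.continuousOn_paceError.mono hmem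
  have hcχ : ContinuousOn (x.chi Q b) (Icc 0 t) :=
    (((euclMap Q).continuous.comp_continuousOn (hx.continuousOn_gammaVec.mono hmem)).const_smul
      b).add
      ((euclMap Q).continuous.comp_continuousOn hcz)
  have hVt : V t ≤ (√M * (opNorm (Smat Q b) * ‖x.xiTC Q 0‖) * Real.exp (-lam * t) + θ * U) ^ 2 := by
    refine le_sq_of_deriv_lt (mul_pos hθ0 hU) (by positivity) ht.1
      ((hcχ.inner (𝕜 := ℝ) (P.continuous.comp_continuousOn hcχ)).add ((hcz.norm.pow 2).const_mul _))
      (fun τ hτ => ((hx.hasDerivWithinAt_chi hn1 hloop hQ1 hQ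
          (hmem τ ⟨hτ.1, hτ.2.le⟩)).inner ℝ (P.hasFDerivAt.comp_hasDerivWithinAt τ
          (hx.hasDerivWithinAt_chi hn1 hloop hQ1 hQ (hmem τ ⟨hτ.1, hτ.2.le⟩)))).add
        (((hx.hasDerivWithinAt_paceError' hn1 hloop hQ1 hQ
          (hmem τ ⟨hτ.1, hτ.2.le⟩)).norm_sq).const_mul (β / 2))) ?_ ?_
    · refine (hVup 0).trans ?_
      rw [mul_pow, Real.sq_sqrt hM0.le]
      refine mul_le_mul_of_nonneg_left ?_ hM0.le
      exact (Real.sqrt_le_left (by positivity)).1 (Run.sqrt_chi_le 0)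
    · intro τ hτ s hs hws
      have hτm := hmem τ ⟨hτ.1, hτ.2.le⟩
      have hf := x.norm_forcing_le (G := G) ha.le hk.le hη (hh τ) (fun j => hx.no_event j τ hτm)
      have hfp := x.norm_forcingPace_le (G := G) ha.le hk.le hη hn1 (hh τ)
        (fun j => hx.no_event j τ hτm)
      have hUτ := hbound τ hτm
      have hd := hdecay (x.chi Q b τ) (x.paceError τ) (euclMap Q (x.forcing G (r * b) kPF η τ))
        (x.forcingPace G (r * b) kPF η τ) U s hU
        ((norm_euclMap_le hQ _).trans (hf.trans (by linarith [abs_nonneg (x.ddγd τ)])))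
        (hfp.trans (by gcongr)) hs hws
      have hsum : ∀ u w, inner ℝ (x.chi Q b τ) (P u) + inner ℝ u (P (x.chi Q b τ))
          + β / 2 * (2 * inner ℝ (x.paceError τ) w)
          = 2 * inner ℝ (P (x.chi Q b τ)) u + β * inner ℝ (x.paceError τ) w := fun u w => by
        rw [← hsym, real_inner_comm (P (x.chi Q b τ)) u]; ring
      exact lt_of_eq_of_lt (hsum _ _) hd
  have hw : √(‖x.chi Q b t‖ ^ 2 + ‖x.paceError t‖ ^ 2) ≤ √(M / μ) * opNorm (Smat Q b) * ‖x.xiTC Q 0‖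
      * Real.exp (-lam * t) + (2 * lambdaMax Ψ + β) / (lam * μ) * U := by
    refine Real.sqrt_le_iff.2 ⟨by positivity,
      le_of_mul_le_mul_left ((hVlow t).trans (hVt.trans_eq ?_))
      hμ0⟩
    have hC : (2 * lambdaMax Ψ + β) / (lam * μ) = θ / √μ := by
      rw [hθ, div_div, mul_right_comm, Real.mul_self_sqrt hμ0.le, mul_comm lam]
    have hsq : √M * (opNorm (Smat Q b) * ‖x.xiTC Q 0‖) * Real.exp (-lam * t) + θ * U
        = √μ * (√(M / μ) * opNorm (Smat Q b) * ‖x.xiTC Q 0‖ * Real.exp (-lam * t)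
          + (2 * lambdaMax Ψ + β) / (lam * μ) * U) := by
      rw [hC, Real.sqrt_div hM0.le]
      field_simp
    rw [hsq, mul_pow, Real.sq_sqrt hμ0.le]
  have h1M : 1 ≤ √(M / μ) := Real.one_le_sqrt.2 ((one_le_div hμ0).2 hμM)
  have hC0 : 0 ≤ (2 * lambdaMax Ψ + β) / (lam * μ) * U := by positivity
  calc ‖x.xiTC Q t‖ ≤ opNorm (Smat Q b)⁻¹ * √(‖x.chi Q b t‖ ^ 2 + ‖x.paceError t‖ ^ 2) :=
        Run.norm_xiTC_le hb.ne' t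
    _ ≤ opNorm (Smat Q b)⁻¹ * (√(M / μ) * opNorm (Smat Q b) * ‖x.xiTC Q 0‖ * Real.exp (-lam * t)
        + √(M / μ) * ((2 * lambdaMax Ψ + β) / (lam * μ) * U)) := by
        refine mul_le_mul_of_nonneg_left (hw.trans ?_) hSi0
        exact add_le_add_right (le_mul_of_one_le_left hC0 h1M) _
    _ = _ := by rw [kappa1, kappa2]; ring

/-! ### Separation of the events -/

/-- A solution of `f' = -b f + g` starting at `0` is bounded by `K / b` if `g < K`. -/
theorem le_div_of_deriv_eq {f g : ℝ → ℝ} {s t b K : ℝ} (hb : 0 < b) (hK : 0 ≤ K)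
    (hcont : ContinuousOn f (Ico s t)) (hf : ∀ σ ∈ Ico s t,
      HasDerivWithinAt f (-b * f σ + g σ) (Ici σ) σ) (hg : ∀ σ ∈ Ico s t, g σ < K) (h0 : f s = 0) :
    ∀ σ ∈ Ico s t, f σ ≤ K / b := by
  intro σ hσ
  refine image_le_of_deriv_right_lt_deriv_boundary (f := f) (f' := fun σ => -b * f σ + g σ)
    (B := fun _ => K / b) (B' := fun _ => 0) (hcont.mono fun y hy => ⟨hy.1, hy.2.trans_lt hσ.2⟩)
    (fun y hy => hf y ⟨hy.1, hy.2.trans hσ.2⟩) (by rw [h0]; positivity)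
    (fun y => hasDerivAt_const y _) ?_ (right_mem_Icc.2 hσ.1)
  intro y hy hfy
  have := hg y ⟨hy.1, hy.2.trans hσ.2⟩
  have h1 : -b * f y = -K := by rw [hfy]; field_simp
  linarith

namespace Run

variable {n : ℕ} {x : Run n} {G : Digraph (Fin n)} {a b kPF η : ℝ} {h : ℝ → ℝ}

theorem IsClosedLoop.τ_nonneg (hx : x.IsClosedLoop G a b kPF η h) (i : Fin n) (k : ℕ) :
    0 ≤ x.τ i k := by
  induction k with
  | zero => rw [hx.τ_zero]
  | succ k ih =>
    rcases hx.τ_lt i k with h1 | h1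
    · exact ih.trans h1.le
    · rw [h1]; exact le_top

theorem norm_euclMap_gammaVec_le (Q : Matrix (Fin (n - 1)) (Fin n) ℝ) (t : ℝ) :
    ‖euclMap Q (x.gammaVec t)‖ ≤ ‖x.xiTC Q t‖ := by
  refine (sq_le_sq₀ (norm_nonneg _) (norm_nonneg _)).1 ?_
  have : x.xiTC Q t
      = WithLp.toLp 2 (Sum.elim (euclMap Q (x.gammaVec t)).ofLp (x.paceError t).ofLp) :=
    rfl
  rw [this, norm_sq_toLp_sumElim]
  linarith [sq_nonneg ‖x.paceError t‖]

/-- After an event the rate of the estimation error obeys a damped equation with bounded input, so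
the error grows at most linearly in time and needs some time to reach the threshold. -/
theorem IsClosedLoop.add_le_τ_succ (hn : 1 ≤ n) (hloop : ∀ i, ¬ G.Adj i i)
    {Q : Matrix (Fin (n - 1)) (Fin n) ℝ} (hQ1 : Q.mulVec (fun _ => 1) = 0)
    (hQ : Q * Q.transpose = 1) (ha : 0 < a) (hb : 0 < b) (hk : 0 < kPF) (hη : 0 < η)
    (hx : x.IsClosedLoop G a b kPF η h) {c H X ρ K : ℝ} (hc : ∀ t, c ≤ h t)
    (hH : ∀ t ∈ x.times, h t ≤ H) (hX : ∀ t ∈ x.times, ‖x.xiTC Q t‖ ≤ X)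
    (hρ : ∀ t ∈ x.times, ‖x.ePF t‖ ≤ ρ)
    (hK : a * (‖euclMap (laplacian G * Q.transpose)‖ * X + n * H) + kPF * ρ < K) (i : Fin n)
    (k : ℕ) : x.τ i k + ((c * b / K : ℝ) : EReal) ≤ x.τ i (k + 1) := by
  rcases eq_or_ne (x.τ i (k + 1)) ⊤ with htop | htop
  · rw [htop]; exact le_top
  have hlt : x.τ i k < x.τ i (k + 1) := (hx.τ_lt i k).resolve_right htop
  have hltT : x.τ i (k + 1) < x.T := (hx.τ_lt_T i (k + 1)).resolve_right htop
  have hbot : ∀ m, x.τ i m ≠ ⊥ := fun m => (EReal.bot_lt_zero.trans_le (hx.τ_nonneg i m)).ne'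
  obtain ⟨s, hs⟩ : ∃ s : ℝ, x.τ i k = s :=
    ⟨_, (EReal.coe_toReal (hlt.trans_le le_top).ne (hbot k)).symm⟩
  obtain ⟨t, ht⟩ : ∃ t : ℝ, x.τ i (k + 1) = t := ⟨_, (EReal.coe_toReal htop (hbot _)).symm⟩
  have hs0 : 0 ≤ s := by have := hx.τ_nonneg i k; rw [hs] at this; exact_mod_cast this
  have hst : s < t := by rw [hs, ht] at hlt; exact_mod_cast hlt
  rw [ht] at hltT
  have hslot : x.slot i k = Ico s t := by
    ext σ
    simp only [slot, times, hs, ht, mem_ofPred_eq, mem_Ico, EReal.coe_le_coe_iff,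
      EReal.coe_lt_coe_iff]
    exact ⟨fun hσ => hσ.2, fun hσ =>
      ⟨⟨hs0.trans hσ.1, lt_trans (EReal.coe_lt_coe_iff.2 hσ.2) hltT⟩, hσ⟩⟩
  have hmem : ∀ σ ∈ Ico s t, σ ∈ x.times := fun σ hσ => (hslot ▸ hσ : σ ∈ x.slot i k).1
  have hsmem : s ∈ Ico s t := left_mem_Ico.2 hst
  have hreset := hx.est_reset i k s hs
  have hestd := hx.est_deriv i k
  have hesto := hx.est_ode i k
  rw [hslot] at hestd hesto
  set g : ℝ → ℝ := fun σ =>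
    a * ∑ j ∈ nbrs G i, (x.γ i σ - x.γhat j σ) - x.alphaBar kPF η i σ with hg
  have hK0 : ∀ σ ∈ Ico s t, |g σ| < K := by
    intro σ hσ
    have hσ' := hmem σ hσ
    have h1 : ∑ j ∈ nbrs G i, (x.γ i σ - x.γhat j σ)
        = (euclMap (laplacian G * Q.transpose) (euclMap Q (x.gammaVec σ))) i
          - ∑ j ∈ nbrs G i, x.e j σ := by
      rw [← euclMap_mul, Matrix.mul_assoc, laplacian_mul_transpose_mul hn hloop hQ1 hQ, gammaVec,
        euclMap_toLp]
      simp only [laplacian_mulVec_apply hloop]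
      rw [← Finset.sum_sub_distrib]
      exact Finset.sum_congr rfl fun j _ => by rw [e]; ring
    have h2 : |(euclMap (laplacian G * Q.transpose) (euclMap Q (x.gammaVec σ))) i|
        ≤ ‖euclMap (laplacian G * Q.transpose)‖ * X := by
      rw [← Real.norm_eq_abs]
      refine (PiLp.norm_apply_le _ i).trans ((ContinuousLinearMap.le_opNorm _ _).trans ?_)
      gcongr
      exact (norm_euclMap_gammaVec_le Q σ).trans (hX σ hσ')
    have hH0 : 0 ≤ H := (abs_nonneg _).trans ((hx.no_event i σ hσ').trans (hH σ hσ'))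
    have h3 := x.abs_sum_e_le (G := G) hH0 (fun j => (hx.no_event j σ hσ').trans (hH σ hσ')) i
    have h4 : |x.alphaBar kPF η i σ| ≤ kPF * ρ := by
      refine (x.abs_alphaBar_le hk.le hη i σ).trans (mul_le_mul_of_nonneg_left ?_ hk.le)
      exact (PiLp.norm_apply_le (x.ePF σ) i).trans (hρ σ hσ')
    refine lt_of_le_of_lt ?_ hK
    refine (abs_sub _ _).trans (add_le_add ?_ h4)
    rw [abs_mul, abs_of_pos ha, h1]
    refine mul_le_mul_of_nonneg_left ?_ ha.le
    exact (abs_sub _ _).trans (add_le_add h2 h3)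
  have hKpos : 0 < K := (abs_nonneg _).trans_lt (hK0 s hsmem)
  have hsub : Ico s t ⊆ Ici 0 := fun σ hσ => (hmem σ hσ).1
  have hcont : ContinuousOn (fun σ => x.dγhat i σ - x.dγ i σ) (Ico s t) :=
    ContinuousOn.sub (fun σ hσ => (hesto σ hσ).continuousWithinAt) ((hx.dγ_cont i).mono hmem)
  have hder : ∀ σ ∈ Ico s t, HasDerivWithinAt (fun σ => x.dγhat i σ - x.dγ i σ)
      (-b * (x.dγhat i σ - x.dγ i σ) + g σ) (Ici σ) σ := by
    intro σ hσ
    refine (((hesto σ hσ).mono_of_mem_nhdsWithin (Ico_mem_nhdsGE_of_mem hσ)).sub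
      (hx.control i σ (hmem σ hσ))).congr_deriv ?_
    rw [hg]; ring
  have hrate : ∀ σ ∈ Ico s t, |x.dγhat i σ - x.dγ i σ| ≤ K / b := by
    intro σ hσ
    refine abs_le'.2 ⟨le_div_of_deriv_eq hb hKpos.le hcont hder
      (fun y hy => (le_abs_self _).trans_lt (hK0 y hy)) (by rw [hreset.2, sub_self]) σ hσ, ?_⟩
    refine le_div_of_deriv_eq (f := fun σ => -(x.dγhat i σ - x.dγ i σ)) (g := fun σ => -g σ)
      hb hKpos.le hcont.neg (fun y hy => (hder y hy).neg.congr_deriv (by ring))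
      (fun y hy => (neg_le_abs _).trans_lt (hK0 y hy)) (by simp [hreset.2]) σ hσ
  have hed : ∀ σ ∈ Ico s t, HasDerivWithinAt (x.e i) (x.dγhat i σ - x.dγ i σ) (Ico s t) σ :=
    fun σ hσ => (hestd σ hσ).sub ((hx.γ_deriv i σ (hmem σ hσ)).mono hsub)
  have he : ∀ σ ∈ Ico s t, |x.e i σ| ≤ K / b * (t - s) := by
    intro σ hσ
    have h1 := norm_image_sub_le_of_norm_deriv_right_le_segment (f := x.e i) (a := s) (b := σ)
      (C := K / b) (fun y hy => ((hed y ⟨hy.1, hy.2.trans_lt hσ.2⟩).continuousWithinAt).mono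
        fun y hy => ⟨hy.1, hy.2.trans_lt hσ.2⟩)
      (fun y hy => (hed y ⟨hy.1, hy.2.trans hσ.2⟩).mono_of_mem_nhdsWithin
        (Ico_mem_nhdsGE_of_mem ⟨hy.1, hy.2.trans hσ.2⟩))
      (fun y hy => hrate y ⟨hy.1, hy.2.trans hσ.2⟩) σ (right_mem_Icc.2 hσ.1)
    have h0 : x.e i s = 0 := by rw [e, hreset.1, sub_self]
    rw [h0, sub_zero, Real.norm_eq_abs] at h1
    refine h1.trans (mul_le_mul_of_nonneg_left ?_ (by positivity))
    linarith [hσ.2]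
  have hlim : h t ≤ K / b * (t - s) := by
    refine le_of_tendsto (hx.event i k t ht) ?_
    filter_upwards [Ioo_mem_nhdsLT hst] with σ hσ
    exact he σ ⟨hσ.1.le, hσ.2⟩
  have hfin : s + c * b / K ≤ t := by
    have h1 : c * b / K ≤ t - s := by
      rw [div_le_iff₀ hKpos]
      calc c * b ≤ K / b * (t - s) * b := by gcongr; exact (hc t).trans hlim
        _ = (t - s) * K := by field_simp
    linarith
  rw [hs, ht]
  exact_mod_cast hfin

end Run

end TimeCoord

theorem theorem1 (n : ℕ) (hn : 2 ≤ n) (G : Digraph (Fin n)) (hloop : ∀ i, ¬ G.Adj i i)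
    (hG : TimeCoord.HasDirectedSpanningTree G)
    (Q : Matrix (Fin (n - 1)) (Fin n) ℝ) (hQ1 : Q.mulVec (fun _ => 1) = 0)
    (hQ : Q * Q.transpose = 1)
    (Ξ : Matrix (Fin (n - 1)) (Fin (n - 1)) ℝ) (hΞ : Ξ.PosDef) :
    ∃ Ψ : Matrix (Fin (n - 1)) (Fin (n - 1)) ℝ, Ψ.PosDef ∧
      (Q * TimeCoord.laplacian G * Q.transpose).transpose * Ψ
        + Ψ * (Q * TimeCoord.laplacian G * Q.transpose) = Ξ ∧
      ∀ β r lam : ℝ, 0 < β → 0 < r → 0 < lam →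
        lam ≤ r * (TimeCoord.lambdaMin Ξ / (3 * TimeCoord.lambdaMax Ψ)) →
        ∃ a b η : ℝ, 0 < a ∧ 0 < b ∧ 0 < η ∧ a / b = r ∧
          ∀ kPF c₁ c₂ c₃ ρ D : ℝ, 0 < kPF → 0 < c₁ → 0 ≤ c₂ → 0 ≤ c₃ → 0 < ρ →
            (∀ x : TimeCoord.Run n,
              x.IsClosedLoop G a b kPF η (TimeCoord.threshold c₁ c₂ c₃) →
              (∀ t ∈ x.times, ‖x.ePF t‖ ≤ ρ) → (∀ t ∈ x.times, |x.ddγd t| ≤ D) →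
              ∀ t ∈ x.times, ‖x.xiTC Q t‖ ≤
                TimeCoord.kappa1 Q Ψ β b * ‖x.xiTC Q 0‖ * Real.exp (-lam * t)
                + TimeCoord.kappa2 Q Ψ β b lam *
                  ⨆ s : x.times, (a * n * √(n : ℝ) * TimeCoord.threshold c₁ c₂ c₃ s
                    + kPF * ‖x.ePF s‖ + |x.ddγd s|)) ∧
            (∀ R : ℝ, ∃ δ : ℝ, 0 < δ ∧ ∀ x : TimeCoord.Run n,
              x.IsClosedLoop G a b kPF η (TimeCoord.threshold c₁ c₂ c₃) →
              (∀ t ∈ x.times, ‖x.ePF t‖ ≤ ρ) → (∀ t ∈ x.times, |x.ddγd t| ≤ D) →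
              ‖x.xiTC Q 0‖ ≤ R →
              ∀ i k, x.τ i k + (δ : EReal) ≤ x.τ i (k + 1)) := by
  have hn1 : 1 ≤ n := by omega
  obtain ⟨Ψ, hΨ, hlyap⟩ :=
    (TimeCoord.posStable_reduced_laplacian hn1 hloop hG hQ1 hQ).exists_lyapunov hΞ
  refine ⟨Ψ, hΨ, hlyap, fun β r lam hβ hr hlam hle => ?_⟩
  obtain ⟨b, hb, hbound⟩ := TimeCoord.exists_gain_norm_xiTC_le hn hloop hQ1 hQ hΨ hΞ hlyap hβ hr
    hlam hle
  have ha : 0 < r * b := mul_pos hr hb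
  have hn0 : (0 : ℝ) < n := by exact_mod_cast hn1
  -- The feedback term is bounded by `kPF ‖e_PF‖` for every `η > 0`, so `η = 1` will do.
  refine ⟨r * b, b, 1, ha, hb, one_pos, mul_div_cancel_right₀ r hb.ne', ?_⟩
  intro kPF c₁ c₂ c₃ ρ D hk hc₁ hc₂ hc₃ hρ
  have hpos : ∀ t, 0 < TimeCoord.threshold c₁ c₂ c₃ t := TimeCoord.threshold_pos hc₁ hc₂ c₃
  have hbdd : ∀ x : TimeCoord.Run n, (∀ t ∈ x.times, ‖x.ePF t‖ ≤ ρ) →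
      (∀ t ∈ x.times, |x.ddγd t| ≤ D) → ∀ t ∈ x.times,
      r * b * n * √(n : ℝ) * TimeCoord.threshold c₁ c₂ c₃ t + kPF * ‖x.ePF t‖ + |x.ddγd t|
        ≤ r * b * n * √(n : ℝ) * (c₁ + c₂) + kPF * ρ + |D| := fun x hxρ hxD t ht => by
    refine add_le_add ?_ ((hxD t ht).trans (le_abs_self D))
    gcongr
    · exact TimeCoord.threshold_le hc₂ hc₃ ht.1
    · exact hxρ t ht
  constructor
  · intro x hx hxρ hxD t ht
    have hle_sup : ∀ t ∈ x.times,
        r * b * n * √(n : ℝ) * TimeCoord.threshold c₁ c₂ c₃ t + kPF * ‖x.ePF t‖ + |x.ddγd t|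
        ≤ ⨆ s : x.times, (r * b * n * √(n : ℝ) * TimeCoord.threshold c₁ c₂ c₃ s
          + kPF * ‖x.ePF s‖ + |x.ddγd s|) := fun t ht =>
      le_ciSup (f := fun s : x.times => r * b * n * √(n : ℝ) * TimeCoord.threshold c₁ c₂ c₃ s
        + kPF * ‖x.ePF s‖ + |x.ddγd s|)
        ⟨_, by rintro _ ⟨s, rfl⟩; exact hbdd x hxρ hxD s s.2⟩ ⟨t, ht⟩
    refine hbound kPF 1 _ hk one_pos (fun t => (hpos t).le) x hx _ ?_ hle_sup t ht
    refine lt_of_lt_of_le ?_ (hle_sup 0 hx.zero_mem_times)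
    have := hpos 0
    positivity
  · intro R
    set U := r * b * n * √(n : ℝ) * (c₁ + c₂) + kPF * ρ + |D| with hU
    have hU0 : 0 < U := by positivity
    set X := TimeCoord.kappa1 Q Ψ β b * |R| + TimeCoord.kappa2 Q Ψ β b lam * U with hX
    -- a bound for the input of the equation of the estimation error, uniform over all runs
    set K := |r * b * (‖TimeCoord.euclMap (TimeCoord.laplacian G * Q.transpose)‖ * X
      + n * (c₁ + c₂)) + kPF * ρ| + 1 with hK
    have hK0 : 0 < K := by positivity
    refine ⟨c₁ * b / K, by positivity, fun x hx hxρ hxD hxR i k => ?_⟩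
    have hκ : 0 ≤ TimeCoord.kappa1 Q Ψ β b :=
      mul_nonneg (mul_nonneg (norm_nonneg _) (Real.sqrt_nonneg _)) (norm_nonneg _)
    refine hx.add_le_τ_succ hn1 hloop hQ1 hQ ha hb hk one_pos (X := X) (H := c₁ + c₂) (ρ := ρ)
      (fun t => ?_) (fun t ht => TimeCoord.threshold_le hc₂ hc₃ ht.1) (fun t ht => ?_) hxρ ?_ i k
    · rw [TimeCoord.threshold]
      have := mul_nonneg hc₂ (Real.exp_nonneg (-c₃ * t))
      linarith
    · refine (hbound kPF 1 _ hk one_pos (fun t => (hpos t).le) x hx U hU0 (hbdd x hxρ hxD) t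
        ht).trans (add_le_add_left ?_ _)
      have hexp : Real.exp (-lam * t) ≤ 1 :=
        Real.exp_le_one_iff.2 (by nlinarith [ht.1, mul_nonneg hlam.le ht.1])
      calc _ ≤ TimeCoord.kappa1 Q Ψ β b * ‖x.xiTC Q 0‖ * 1 :=
            mul_le_mul_of_nonneg_left hexp (mul_nonneg hκ (norm_nonneg _))
        _ ≤ TimeCoord.kappa1 Q Ψ β b * |R| := by
            rw [mul_one]
            exact mul_le_mul_of_nonneg_left (hxR.trans (le_abs_self R)) hκ
    · exact (le_abs_self _).trans_lt (lt_add_one _)
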